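/- Let $\Omega=\mathbb R$, or $\Omega=[-\ell,\ell]$ with $\ell>0$. Let $\mathcal P_2(\Omega)$ be the set of Borel probability measures on $\Omega$ with finite second moment, with the quadratic Wasserstein distance $d_2(\mu,\nu)=\inf_\gamma\left(\int|x-y|^2\,d\gamma(x,y)\right)^{1/2}$, the infimum being over all transport plans $\gamma$ between $\mu$ and $\nu$. Let $H:[0,\infty)\to\mathbb R$ and put $h(x)=xH(1/x)$ for $x>0$. Assume that either - $H(x)=x\log x$ for all $x\ge 0$ (with $0\log 0=0$), or - (a) $H$ is convex, non-negative, continuous on $[0,\infty)$ and $C^\infty$ on $(0,\infty)$, $H(0)=0$, $H(x)/x\to\infty$ as $x\to\infty$, there is $A>0$ with $H(x+y)\le A(1+H(x)+H(y))$ for all $x,y\ge0$, and $h$ is convex and non-increasing on $(0,\infty)$; and (b) there are continuous functions $f_1,f_2:[0,\infty)\to\mathbb R$ with $f_1(1)=1$, $f_2(1)=0$ and $H(\alpha x)\le f_1(\alpha)H(x)+f_2(\alpha)x$ for all $x,\alpha\ge 0$. For $\rho\in\mathcal P_2(\Omega)$ let $E(\rho)=\int_\Omega H(\rho(x))\,dx\in\mathbb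 R\cup\{+\infty\}$ if $\rho$ is absolutely continuous with density $\rho(x)$, and $E(\rho)=+\infty$ otherwise. For $N\ge2$ let $\mathcal A_N(\Omega)$ be the set of measures $\mu_N=\frac1N\sum_{i=1}^N\delta_{x_i}$ with $x_1<\dots<x_N$ in $\Omega$, and let $$E_N(\mu_N)=\frac1N\sum_{i=1}^N h(N r_i),\qquad r_i=\min(\Delta x_i,\Delta x_{i+1}),\qquad \Delta x_i=x_i-x_{i-1},$$ with the following fictitious particles. If $\Omega=\mathbb R$, then $x_0=-\infty$ and $x_{N+1}=+\infty$. If $\Omega=[-\ell,\ell]$, then $x_0=-\infty$ if $x_1\in(-\ell,\ell)$ and $x_0=-2\ell-x_2$ if $x_1=-\ell$, and $x_{N+1}=+\infty$ if $x_N\in(-\ell,\ell)$ and $x_{N+1}=2\ell-x_{N-1}$ if $x_N=\ell$. Then $(E_N)_{N\ge2}$ $\Gamma$-converges to $E$ with respect to $d_2$, that is, for every $\rho\in\mathcal P_2(\Omega)$: 1. every sequence $(\mu_N)_{N\ge2}$ with $\mu_N\in\mathcal A_N(\Omega)$ for all $N\ge 2$ and $d_2(\mu_N,\rho)\to0$ satisfies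 $E(\rho)\le\liminf_{N\to\infty}E_N(\mu_N)$; 2. there is a sequence $(\mu_N)_{N\ge2}$ with $\mu_N\in\mathcal A_N(\Omega)$ for all $N\ge 2$, $d_2(\mu_N,\rho)\to0$ and $\limsup_{N\to\infty}E_N(\mu_N)\le E(\rho)$. -/

import Mathlib

open MeasureTheory Filter Topology
open scoped ENNReal

noncomputable section

namespace ParticleDiffusion

/-! ### The spatial domain -/

/-- The spatial domain: the whole line, or the interval `[-ℓ, ℓ]` with `ℓ > 0`. -/
inductive Domain : Type
  | line : Domain
  | interval (ℓ : ℝ) (hℓ : 0 < ℓ) : Domain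

/-- The underlying closed subset of `ℝ`. -/
def Domain.carrier : Domain → Set ℝ
  | .line => Set.univ
  | .interval ℓ _ => Set.Icc (-ℓ) ℓ

/-! ### Probability measures with finite second moment and the quadratic Wasserstein distance -/

/-- Borel probability measures on the domain with finite second moment. A measure on the domain is
identified with the measure on `ℝ` that it induces, which is concentrated on the domain. -/
def P2 (D : Domain) : Set (Measure ℝ) :=
  {μ | IsProbabilityMeasure μ ∧ μ D.carrierᶜ = 0 ∧ ∫⁻ x, ‖x‖ₑ ^ 2 ∂μ < ∞}

/-- Transport plans: measures on the product with the two prescribed marginals. -/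
def transportPlans (μ ν : Measure ℝ) : Set (Measure (ℝ × ℝ)) :=
  {γ | γ.map Prod.fst = μ ∧ γ.map Prod.snd = ν}

/-- The quadratic Wasserstein distance, with values in `[0, ∞]` (it is finite between measures with
finite second moments). -/
def d2 (μ ν : Measure ℝ) : ℝ≥0∞ :=
  ⨅ γ ∈ transportPlans μ ν, (∫⁻ p, edist p.1 p.2 ^ 2 ∂γ) ^ (1 / 2 : ℝ)

/-! ### Densities of internal energy -/

/-- The function `h(x) = x H(1/x)` associated with a density of internal energy `H`. -/
def hOf (H : ℝ → ℝ) (x : ℝ) : ℝ := x * H x⁻¹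

/-- The density of internal energy of the heat equation. Only the values of `H` on `[0, ∞)` are
relevant; note that `Real.log 0 = 0`, so that `H 0 = 0`. -/
def IsHeatEntropy (H : ℝ → ℝ) : Prop := ∀ x : ℝ, 0 ≤ x → H x = x * Real.log x

/-- The structural hypothesis on a general density of internal energy `H : [0, ∞) → ℝ`. Only the
values of `H` on `[0, ∞)` are relevant. `H` is real-valued, hence proper. -/
structure IsGeneralDensity (H : ℝ → ℝ) : Prop where
  convex : ConvexOn ℝ (Set.Ici 0) H
  nonneg : ∀ x : ℝ, 0 ≤ x → 0 ≤ H x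
  smooth : ContDiffOn ℝ ((⊤ : ℕ∞) : WithTop ℕ∞) H (Set.Ioi 0)
  continuous : ContinuousOn H (Set.Ici 0)
  superlinear : Tendsto (fun x => H x / x) atTop atTop
  zero : H 0 = 0
  doubling : ∃ A : ℝ, 0 < A ∧ ∀ x y : ℝ, 0 ≤ x → 0 ≤ y → H (x + y) ≤ A * (1 + H x + H y)
  h_convex : ConvexOn ℝ (Set.Ioi 0) (hOf H)
  h_antitone : AntitoneOn (hOf H) (Set.Ioi 0)

/-- The growth bound `H(αx) ≤ f₁(α) H(x) + f₂(α) x` with `f₁, f₂` continuous on `[0, ∞)`,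
`f₁(1) = 1` and `f₂(1) = 0`. -/
def HasScalingBound (H : ℝ → ℝ) : Prop :=
  ∃ f₁ f₂ : ℝ → ℝ, ContinuousOn f₁ (Set.Ici 0) ∧ ContinuousOn f₂ (Set.Ici 0) ∧
    f₁ 1 = 1 ∧ f₂ 1 = 0 ∧
    ∀ x α : ℝ, 0 ≤ x → 0 ≤ α → H (α * x) ≤ f₁ α * H x + f₂ α * x

/-! ### The continuum energy -/

/-- The continuum energy: `∫ H(ρ(x)) dx` over the domain if `ρ` is absolutely continuous, where
`ρ(x)` is the Lebesgue density of `ρ`, and `+∞` otherwise. The integral is the extended Lebesgue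
integral, i.e. the integral of the positive part minus the integral of the negative part; for the
densities of internal energy and the measures considered here the latter is always finite. -/
def continuumEnergy (H : ℝ → ℝ) (D : Domain) (ρ : Measure ℝ) : EReal :=
  open Classical in
  if ρ ≪ volume then
    ((∫⁻ x in D.carrier, ENNReal.ofReal (H (ρ.rnDeriv volume x).toReal) : ℝ≥0∞) : EReal) -
      ((∫⁻ x in D.carrier, ENNReal.ofReal (-H (ρ.rnDeriv volume x).toReal) : ℝ≥0∞) : EReal)
  else ⊤

/-! ### Particles and the discrete energy -/

/-- `x 1 < ⋯ < x N` are particles in the domain. Values of `x` at other indices are irrelevant. -/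
def IsParticles (D : Domain) (N : ℕ) (x : ℕ → ℝ) : Prop :=
  StrictMonoOn x (Set.Icc 1 N) ∧ ∀ i ∈ Set.Icc 1 N, x i ∈ D.carrier

/-- The empirical measure `(1/N) ∑ δ_{x i}`. -/
def empirical (N : ℕ) (x : ℕ → ℝ) : Measure ℝ :=
  (N : ℝ≥0∞)⁻¹ • ∑ i ∈ Finset.Icc 1 N, Measure.dirac (x i)

/-- Atomic measures with `N` distinct equally weighted particles in the domain. -/
def atomicMeasures (D : Domain) (N : ℕ) : Set (Measure ℝ) :=
  {μ | μ ∈ P2 D ∧ ∃ x : ℕ → ℝ, IsParticles D N x ∧ μ = empirical N x}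

/-- The fictitious particle `x 0`. On `[-ℓ, ℓ]` the second case occurs only if `x 1 = -ℓ`. -/
def leftGhost : Domain → (ℕ → ℝ) → EReal
  | .line, _ => ⊥
  | .interval ℓ _, x =>
      open Classical in
      if x 1 ∈ Set.Ioo (-ℓ) ℓ then ⊥ else ((-2 * ℓ - x 2 : ℝ) : EReal)

/-- The fictitious particle `x (N + 1)`. On `[-ℓ, ℓ]` the second case occurs only if `x N = ℓ`. -/
def rightGhost : Domain → ℕ → (ℕ → ℝ) → EReal
  | .line, _, _ => ⊤
  | .interval ℓ _, N, x =>
      open Classical in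
      if x N ∈ Set.Ioo (-ℓ) ℓ then ⊤ else ((2 * ℓ - x (N - 1) : ℝ) : EReal)

/-- The positions `x 0, …, x (N + 1)`, fictitious particles included. -/
def position (D : Domain) (N : ℕ) (x : ℕ → ℝ) (i : ℕ) : EReal :=
  if i = 0 then leftGhost D x else if i = N + 1 then rightGhost D N x else (x i : EReal)

/-- The inter-particle distance `Δx i = x i - x (i - 1)` for `1 ≤ i ≤ N + 1`. -/
def gap (D : Domain) (N : ℕ) (x : ℕ → ℝ) (i : ℕ) : EReal :=
  position D N x i - position D N x (i - 1)

/-- `r i = min (Δx i) (Δx (i + 1))` for `1 ≤ i ≤ N`, a finite number as soon as `N ≥ 2`. -/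
def radius (D : Domain) (N : ℕ) (x : ℕ → ℝ) (i : ℕ) : ℝ :=
  (min (gap D N x i) (gap D N x (i + 1))).toReal

/-- The discrete energy as a function of the particles. -/
def particleEnergy (H : ℝ → ℝ) (D : Domain) (N : ℕ) (x : ℕ → ℝ) : ℝ :=
  (1 / (N : ℝ)) * ∑ i ∈ Finset.Icc 1 N, hOf H (N * radius D N x i)

/-- The discrete energy of an atomic measure: the energy of its particles, which are determined
by the measure. The value at measures that are not of this form is irrelevant. -/
def discreteEnergy (H : ℝ → ℝ) (D : Domain) (N : ℕ) (μ : Measure ℝ) : ℝ :=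
  open Classical in
  if hμ : ∃ x : ℕ → ℝ, IsParticles D N x ∧ μ = empirical N x then
    particleEnergy H D N hμ.choose
  else 0

/-! ### The discrete energy is well defined -/

theorem empirical_singleton_ne_zero (N : ℕ) (x : ℕ → ℝ) (y : ℝ) :
    empirical N x {y} ≠ 0 ↔ ∃ i ∈ Finset.Icc 1 N, x i = y := by
  simp only [empirical, Measure.smul_apply, Measure.finsetSum_apply, smul_eq_mul, ne_eq,
    mul_eq_zero, ENNReal.inv_eq_zero, ENNReal.natCast_ne_top, false_or, Finset.sum_eq_zero_iff,
    not_forall, Measure.dirac_apply' _ (measurableSet_singleton y), Set.indicator_apply,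
    Set.mem_singleton_iff, Pi.one_apply, ite_eq_right_iff, one_ne_zero, imp_false, not_not,
    exists_prop]

theorem eqOn_of_empirical_eq {D D' : Domain} {N : ℕ} {x y : ℕ → ℝ} (hx : IsParticles D N x)
    (hy : IsParticles D' N y) (h : empirical N x = empirical N y) :
    Set.EqOn x y (Set.Icc 1 N) := by
  have mono : ∀ {E : Domain} {z : ℕ → ℝ}, IsParticles E N z →
      StrictMono (fun i : Fin N => z (i + 1)) := by
    intro E z hz i j hij
    exact hz.1 ⟨by omega, by omega⟩ ⟨by omega, by omega⟩ (by simpa using hij)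
  have rng : ∀ z : ℕ → ℝ,
      Set.range (fun i : Fin N => z (i + 1)) = {y | empirical N z {y} ≠ 0} := by
    intro z
    ext y
    simp only [Set.mem_range, Set.mem_ofPred_eq, empirical_singleton_ne_zero]
    constructor
    · rintro ⟨i, hi⟩
      exact ⟨i + 1, Finset.mem_Icc.2 ⟨by omega, by omega⟩, hi⟩
    · rintro ⟨i, hi, hiy⟩
      obtain ⟨h1, h2⟩ := Finset.mem_Icc.1 hi
      refine ⟨⟨i - 1, by omega⟩, ?_⟩
      simpa [Nat.sub_add_cancel h1] using hiy
  have key := (StrictMono.range_inj (mono hx) (mono hy)).1 (by rw [rng, rng, h])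
  rintro i ⟨h1, h2⟩
  have := congrFun key ⟨i - 1, by omega⟩
  simpa [Nat.sub_add_cancel h1] using this

theorem particleEnergy_congr (H : ℝ → ℝ) (D : Domain) {N : ℕ} (hN : 2 ≤ N) {x y : ℕ → ℝ}
    (h : Set.EqOn x y (Set.Icc 1 N)) : particleEnergy H D N x = particleEnergy H D N y := by
  have hL : leftGhost D x = leftGhost D y := by
    cases D with
    | line => rfl
    | interval ℓ hℓ => simp only [leftGhost, h (x := 1) ⟨by omega, by omega⟩,
        h (x := 2) ⟨by omega, by omega⟩]
  have hR : rightGhost D N x = rightGhost D N y := by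
    cases D with
    | line => rfl
    | interval ℓ hℓ => simp only [rightGhost, h (x := N) ⟨by omega, by omega⟩,
        h (x := N - 1) ⟨by omega, by omega⟩]
  have hpos : ∀ i ≤ N + 1, position D N x i = position D N y i := by
    intro i hi
    unfold position
    split_ifs with h0 h1
    · exact hL
    · exact hR
    · rw [h (x := i) ⟨by omega, by omega⟩]
  unfold particleEnergy
  congr 1
  refine Finset.sum_congr rfl fun i hi => ?_
  obtain ⟨h1, h2⟩ := Finset.mem_Icc.1 hi
  simp only [radius, gap, hpos i (by omega), hpos (i - 1) (by omega), hpos (i + 1) (by omega),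
    Nat.add_sub_cancel]

/-- The discrete energy of an empirical measure is the energy of its particles. -/
theorem discreteEnergy_empirical (H : ℝ → ℝ) (D : Domain) {N : ℕ} (hN : 2 ≤ N) {x : ℕ → ℝ}
    (hx : IsParticles D N x) : discreteEnergy H D N (empirical N x) = particleEnergy H D N x := by
  have hex : ∃ y : ℕ → ℝ, IsParticles D N y ∧ empirical N x = empirical N y := ⟨x, hx, rfl⟩
  unfold discreteEnergy
  rw [dif_pos hex]
  exact particleEnergy_congr H D hN
    (eqOn_of_empirical_eq hex.choose_spec.1 hx hex.choose_spec.2.symm)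

/-! ### Γ-convergence -/

/-- `μ N`, `N ≥ 2`, is a recovery sequence for `ρ` with respect to `d2`. -/
def IsRecoverySequence (H : ℝ → ℝ) (D : Domain) (ρ : Measure ℝ) (μ : ℕ → Measure ℝ) : Prop :=
  (∀ N, 2 ≤ N → μ N ∈ atomicMeasures D N) ∧
    Tendsto (fun N => d2 (μ N) ρ) atTop (𝓝 0) ∧
    limsup (fun N => (discreteEnergy H D N (μ N) : EReal)) atTop ≤ continuumEnergy H D ρ

/-- Γ-convergence, with respect to `d2`, of the discrete energies to the continuum energy. -/
def GammaConverges (H : ℝ → ℝ) (D : Domain) : Prop :=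
  ∀ ρ ∈ P2 D,
    (∀ μ : ℕ → Measure ℝ, (∀ N, 2 ≤ N → μ N ∈ atomicMeasures D N) →
      Tendsto (fun N => d2 (μ N) ρ) atTop (𝓝 0) →
      continuumEnergy H D ρ ≤
        liminf (fun N => (discreteEnergy H D N (μ N) : EReal)) atTop) ∧
    ∃ μ : ℕ → Measure ℝ, IsRecoverySequence H D ρ μ

end ParticleDiffusion

end

namespace ParticleDiffusion

/-! ### Admissible densities -/

/-! Both inequalities rest on reading the discrete energy as an integral.

Lower bound. Spreading the mass 1/N of each particle uniformly over an interval of length `radius`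
centred at it gives a probability density. The intervals are disjoint and H(0) = 0, so the continuum
integral of H of this density equals the discrete energy exactly
(`IsParticles.integral_comp_stepDensity`). Bounded second moments force the spread to be o(N), so
these densities have the same limit ρ as the particles. What remains is lower semicontinuity of a
convex integral functional: superlinear growth gives uniform integrability
(`DensityApprox.equiintegrable`), hence absolute continuity of ρ and convergence against bounded
measurable integrable test functions; then H is linearised at the density of ρ on sets where that
density is bounded above and away from zero (`DensityApprox.core_energy_le`), and these sets exhaust
its support.

H may be negative, as for x log x, and the line has infinite measure. Both difficulties are met by
the inequality `lower`: H(s) + ts + exp(-t) ≥ 0. With t = |x| + m the added terms are controlled by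
first moments, and the remainder is exp(-m) times a constant, which vanishes as m → ∞.

Recovery sequence. If ρ has a density of finite energy, put particles at the quantiles of the
midpoints of N equal cells. In the variable u ∈ (0,1) the discrete energy is the integral of a step
function. The quantile function is differentiable a.e. with derivative 1/ρ, so N times the radius
tends to 1/ρ and the integrand converges a.e. to h(1/ρ), whose integral is the continuum energy. For
the limsup, the energy of a particle is bounded by the positive parts of the energies of its two
neighbouring gaps; Jensen's inequality bounds the integral of this majorant by that of its own
pointwise limit, so a reverse Fatou lemma applies (`eventually_integral_lt_of_le_majorant`). If the
energy is infinite, any sequence of distinct particles converging to ρ will do. -/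

/-- The properties of the density of internal energy that the proof uses. They hold for the heat
entropy as well as for the general densities. -/
structure IsAdmissible (H : ℝ → ℝ) : Prop where
  convex : ConvexOn ℝ (Set.Ici 0) H
  continuousOn : ContinuousOn H (Set.Ici 0)
  zero : H 0 = 0
  superlinear : Tendsto (fun x => H x / x) atTop atTop
  contDiffOn : ContDiffOn ℝ 1 H (Set.Ioi 0)
  antitone : AntitoneOn (hOf H) (Set.Ioi 0)
  -- A Young-type inequality, trivial for non-negative H. It is the only control on the negative
  -- part of H, and t will be chosen as a function of the space variable so that exp(-t) is
  -- integrable.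
  lower : ∀ s t : ℝ, 0 ≤ s → 0 ≤ t → 0 ≤ H s + t * s + Real.exp (-t)

theorem IsGeneralDensity.isAdmissible {H : ℝ → ℝ} (hH : IsGeneralDensity H) :
    IsAdmissible H where
  convex := hH.convex
  continuousOn := hH.continuous
  zero := hH.zero
  superlinear := hH.superlinear
  contDiffOn := hH.smooth.of_le (by exact_mod_cast le_top)
  antitone := hH.h_antitone
  lower s t hs ht := by
    have := hH.nonneg s hs
    positivity

theorem IsHeatEntropy.isAdmissible {H : ℝ → ℝ} (hH : IsHeatEntropy H) : IsAdmissible H where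
  convex := Real.convexOn_mul_log.congr fun x hx => (hH x hx).symm
  continuousOn := Real.continuous_mul_log.continuousOn.congr fun x hx => hH x hx
  zero := by simp [hH 0 le_rfl]
  superlinear := Real.tendsto_log_atTop.congr' <| by
    filter_upwards [eventually_gt_atTop 0] with x hx
    rw [hH x hx.le, mul_div_cancel_left₀ _ hx.ne']
  contDiffOn := by
    have : ContDiffOn ℝ 1 (fun x : ℝ => x * Real.log x) (Set.Ioi 0) :=
      contDiffOn_id.mul (contDiffOn_id.log fun x hx => (Set.mem_Ioi.1 hx).ne')
    exact this.congr fun x hx => hH x (le_of_lt hx)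
  antitone := by
    intro x hx y hy hxy
    have hx' : 0 < x := hx
    have hy' : 0 < y := hy
    have key : ∀ z : ℝ, 0 < z → hOf H z = -Real.log z := by
      intro z hz
      rw [hOf, hH _ (by positivity), Real.log_inv]
      field_simp
    rw [key x hx', key y hy', neg_le_neg_iff]
    exact Real.log_le_log hx' hxy
  lower s t hs ht := by
    rcases hs.eq_or_lt with rfl | hs
    · simp [hH 0 le_rfl, Real.exp_nonneg]
    · rw [hH s hs.le]
      -- Applying log y ≤ y - 1 at y = exp(-t)/s and multiplying by s leaves even the surplus s on
      -- the favourable side.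
      have h1 := Real.log_le_sub_one_of_pos (x := Real.exp (-t) / s) (by positivity)
      rw [Real.log_div (Real.exp_pos _).ne' hs.ne', Real.log_exp] at h1
      have h2 := mul_le_mul_of_nonneg_left h1 hs.le
      have h3 : s * (Real.exp (-t) / s - 1) = Real.exp (-t) - s := by field_simp
      rw [h3] at h2
      linarith

namespace IsAdmissible

variable {H : ℝ → ℝ}

theorem hasDerivAt (hH : IsAdmissible H) {t : ℝ} (ht : 0 < t) : HasDerivAt H (deriv H t) t :=
  (hH.contDiffOn.differentiableOn one_ne_zero).differentiableAt (Ioi_mem_nhds ht) |>.hasDerivAt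

theorem continuousOn_deriv (hH : IsAdmissible H) : ContinuousOn (deriv H) (Set.Ioi 0) :=
  hH.contDiffOn.continuousOn_deriv_of_isOpen isOpen_Ioi le_rfl

theorem tangent_le (hH : IsAdmissible H) {s t : ℝ} (ht : 0 < t) (hs : 0 ≤ s) :
    H t + deriv H t * (s - t) ≤ H s := by
  have hd := hH.hasDerivAt ht
  rcases lt_trichotomy s t with h | rfl | h
  · have := hH.convex.slope_le_of_hasDerivAt hs ht.le h hd
    rw [slope_def_field, div_le_iff₀ (by linarith)] at this
    linarith
  · simp
  · have := hH.convex.le_slope_of_hasDerivAt ht.le hs h hd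
    rw [slope_def_field, le_div_iff₀ (by linarith)] at this
    linarith

theorem measurable_comp (hH : IsAdmissible H) {α : Type*} [MeasurableSpace α] {f : α → ℝ}
    (hf : Measurable f) (h0 : ∀ x, 0 ≤ f x) : Measurable fun x => H (f x) := by
  -- Nothing is known about H on negative numbers; this extension agrees with H on [0, ∞) and is
  -- continuous everywhere.
  have hc : Continuous fun x : ℝ => H (max x 0) :=
    hH.continuousOn.comp_continuous (by fun_prop) fun x => Set.mem_Ici.2 (le_max_right _ _)
  simpa [Function.comp_def, max_eq_left (h0 _)] using hc.measurable.comp hf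

/-- Above the threshold M superlinearity gives H(s) ≥ Ls; below it Ls ≤ LM and the rest is
non-negative by `lower`. This is the de la Vallée-Poussin input for uniform integrability. -/
theorem exists_mul_le (hH : IsAdmissible H) {L : ℝ} (hL : 0 < L) :
    ∃ M : ℝ, 0 < M ∧ ∀ s t : ℝ, 0 ≤ s → 0 ≤ t →
      L * s ≤ H s + t * s + Real.exp (-t) + L * M := by
  obtain ⟨M, hM⟩ := eventually_atTop.1 (hH.superlinear.eventually_ge_atTop L)
  refine ⟨max M 1, by positivity, fun s t hs ht => ?_⟩
  rcases le_total s (max M 1) with h | h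
  · have := hH.lower s t hs ht
    nlinarith
  · have h1 : 0 < s := lt_of_lt_of_le (by positivity) h
    have h2 := hM s (le_trans (le_max_left _ _) h)
    rw [le_div_iff₀ h1] at h2
    have : 0 < max M 1 := by positivity
    have := Real.exp_pos (-t)
    have : 0 ≤ t * s := by positivity
    have : 0 ≤ L * max M 1 := by positivity
    linarith

theorem continuousOn_hOf (hH : IsAdmissible H) : ContinuousOn (hOf H) (Set.Ioi 0) := by
  refine continuousOn_id.mul (hH.continuousOn.comp ?_ ?_)
  · exact continuousOn_id.inv₀ fun x hx => (Set.mem_Ioi.1 hx).ne'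
  · intro x hx
    exact inv_nonneg.2 (le_of_lt (Set.mem_Ioi.1 hx))

end IsAdmissible

/-! ### Lower semicontinuity of the continuum energy -/

theorem integrable_exp_neg_abs : Integrable fun x : ℝ => Real.exp (-|x|) := by
  rw [← integrableOn_univ, ← Set.Iic_union_Ioi (a := (0 : ℝ)), integrableOn_union]
  constructor
  · refine (integrableOn_exp_Iic 0).congr_fun (fun x hx => ?_) measurableSet_Iic
    simp [abs_of_nonpos (Set.mem_Iic.1 hx)]
  · refine (integrableOn_exp_neg_Ioi 0).congr_fun (fun x hx => ?_) measurableSet_Ioi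
    simp [abs_of_pos (Set.mem_Ioi.1 hx)]

/-- Probability densities on the line that converge to `ρ` when tested against Lipschitz
functions. -/
structure DensityApprox (ρ : Measure ℝ) (f : ℕ → ℝ → ℝ) : Prop where
  measurable : ∀ n, Measurable (f n)
  nonneg : ∀ n x, 0 ≤ f n x
  integrable : ∀ n, Integrable (f n)
  integral_eq : ∀ n, ∫ x, f n x = 1
  integrable_abs : ∀ n, Integrable fun x => |x| * f n x
  tendsto_lipschitz : ∀ (φ : ℝ → ℝ) (K : NNReal), LipschitzWith K φ →
    Tendsto (fun n => ∫ x, φ x * f n x) atTop (𝓝 (∫ x, φ x ∂ρ))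

/-- The energies of the densities `f n` are bounded by `c`. -/
structure EnergyBound (H : ℝ → ℝ) (f : ℕ → ℝ → ℝ) (c : ℝ) : Prop where
  integrable : ∀ n, Integrable fun x => H (f n x)
  integral_le : ∀ n, ∫ x, H (f n x) ≤ c

section

variable {H : ℝ → ℝ} {ρ : Measure ℝ} {f : ℕ → ℝ → ℝ} {c : ℝ}

/-- The measures with densities `f n`. -/
noncomputable def densityMeasure (f : ℕ → ℝ → ℝ) (n : ℕ) : Measure ℝ :=
  volume.withDensity fun x => ENNReal.ofReal (f n x)

theorem DensityApprox.isProbabilityMeasure (hf : DensityApprox ρ f) (n : ℕ) :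
    IsProbabilityMeasure (densityMeasure f n) := by
  refine ⟨?_⟩
  rw [densityMeasure, withDensity_apply _ .univ, Measure.restrict_univ, ← ofReal_integral_eq_lintegral_ofReal (hf.integrable n) (ae_of_all _ (hf.nonneg n)),
    hf.integral_eq n, ENNReal.ofReal_one]

theorem DensityApprox.integral_densityMeasure (hf : DensityApprox ρ f) (n : ℕ) (φ : ℝ → ℝ) :
    ∫ x, φ x ∂densityMeasure f n = ∫ x, φ x * f n x := by
  rw [densityMeasure, integral_withDensity_eq_integral_toReal_smul
    (hf.measurable n).ennreal_ofReal (by simp)]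
  refine integral_congr_ae (ae_of_all _ fun x => ?_)
  simp [ENNReal.toReal_ofReal (hf.nonneg n x), mul_comm]

theorem DensityApprox.densityMeasure_real (hf : DensityApprox ρ f) (n : ℕ) {A : Set ℝ}
    (hA : MeasurableSet A) : (densityMeasure f n).real A = ∫ x in A, f n x := by
  rw [measureReal_def, densityMeasure, withDensity_apply _ hA,
    ← ofReal_integral_eq_lintegral_ofReal (hf.integrable n).integrableOn
      (ae_of_all _ (hf.nonneg n)), ENNReal.toReal_ofReal]
  exact integral_nonneg (hf.nonneg n)

/-! ### Uniform integrability and its consequences for the limit. -/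

/-- |x| is Lipschitz, so the first moments converge and are bounded. The added terms make the
integrand non-negative, which allows restriction to subsets. -/
theorem DensityApprox.exists_modified_energy_le (hf : DensityApprox ρ f)
    (hE : EnergyBound H f c) : ∃ K : ℝ, 0 < K ∧
      ∀ n, ∫ x, (H (f n x) + |x| * f n x + Real.exp (-|x|)) ≤ K := by
  have hlip : LipschitzWith 1 (fun x : ℝ => |x|) := lipschitzWith_one_norm
  obtain ⟨B, hB⟩ := (hf.tendsto_lipschitz _ 1 hlip).bddAbove_range
  refine ⟨max (c + B + ∫ x : ℝ, Real.exp (-|x|)) 1, by positivity, fun n => le_max_of_le_left ?_⟩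
  have hi : Integrable fun x => H (f n x) + |x| * f n x :=
    (hE.integrable n).add (hf.integrable_abs n)
  rw [integral_add hi integrable_exp_neg_abs, integral_add (hE.integrable n) (hf.integrable_abs n)]
  have := hE.integral_le n
  have := hB ⟨n, rfl⟩
  simp only at this
  linarith

theorem DensityApprox.equiintegrable (hf : DensityApprox ρ f) (hH : IsAdmissible H)
    (hE : EnergyBound H f c) {ε : ℝ} (hε : 0 < ε) : ∃ η : ℝ, 0 < η ∧
      ∀ A : Set ℝ, MeasurableSet A → volume A ≤ ENNReal.ofReal η →
        ∀ n, (densityMeasure f n).real A ≤ ε := by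
  obtain ⟨K, hK, hKb⟩ := hf.exists_modified_energy_le hE
  obtain ⟨M, hM, hMb⟩ := hH.exists_mul_le (L := 2 * K / ε) (by positivity)
  -- With L = 2K/ε, the integral of L f over A is at most K + L M |A|, and |A| ≤ ε/(2M) makes this
  -- at most 2K = Lε.
  refine ⟨ε / (2 * M), by positivity, fun A hA hvol n => ?_⟩
  rw [hf.densityMeasure_real n hA]
  set L := 2 * K / ε with hL
  have hLpos : 0 < L := by positivity
  set F : ℝ → ℝ := fun x => H (f n x) + |x| * f n x + Real.exp (-|x|) with hF
  have hFint : Integrable F :=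
    ((hE.integrable n).add (hf.integrable_abs n)).add integrable_exp_neg_abs
  have hF0 : ∀ x, 0 ≤ F x := fun x => hH.lower _ _ (hf.nonneg n x) (abs_nonneg x)
  have hAfin : volume A ≠ ∞ := (hvol.trans_lt ENNReal.ofReal_lt_top).ne
  have h1 : ∫ x in A, L * f n x ≤ ∫ x in A, (F x + L * M) := by
    refine setIntegral_mono ((hf.integrable n).const_mul L).integrableOn
      (hFint.integrableOn.add (integrableOn_const hAfin)) fun x => ?_
    exact hMb _ _ (hf.nonneg n x) (abs_nonneg x)
  rw [integral_const_mul, integral_add hFint.integrableOn (integrableOn_const hAfin),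
    setIntegral_const, smul_eq_mul] at h1
  have h2 : ∫ x in A, F x ≤ K :=
    (setIntegral_le_integral hFint (ae_of_all _ hF0)).trans (hKb n)
  have h3 : volume.real A ≤ ε / (2 * M) := by
    rw [measureReal_def]
    exact ENNReal.toReal_le_of_le_ofReal (by positivity) hvol
  have h4 : volume.real A * (L * M) ≤ K := by
    calc volume.real A * (L * M) ≤ ε / (2 * M) * (L * M) := by gcongr
      _ = K := by rw [hL]; field_simp
  have h5 : L * ∫ x in A, f n x ≤ L * ε := by
    have : L * ε = 2 * K := by rw [hL]; field_simp
    linarith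
  exact le_of_mul_le_mul_left h5 hLpos

/-- The probability measures with densities `f n`. -/
noncomputable def DensityApprox.probabilityMeasure (hf : DensityApprox ρ f) (n : ℕ) :
    ProbabilityMeasure ℝ :=
  ⟨densityMeasure f n, hf.isProbabilityMeasure n⟩

theorem DensityApprox.tendsto_probabilityMeasure [IsProbabilityMeasure ρ]
    (hf : DensityApprox ρ f) :
    Tendsto hf.probabilityMeasure atTop (𝓝 (⟨ρ, inferInstance⟩ : ProbabilityMeasure ℝ)) := by
  refine tendsto_iff_forall_lipschitz_integral_tendsto.2 ?_
  rintro φ - ⟨K, hφ⟩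
  simpa [DensityApprox.probabilityMeasure, hf.integral_densityMeasure] using hf.tendsto_lipschitz φ K hφ

/-- Outer regularity replaces A by an open set that is still small, and the mass of open sets is
weakly lower semicontinuous. -/
theorem DensityApprox.limit_equiintegrable [IsProbabilityMeasure ρ] (hf : DensityApprox ρ f)
    {ε η : ℝ}
    (hη : ∀ A : Set ℝ, MeasurableSet A → volume A ≤ ENNReal.ofReal η →
        ∀ n, (densityMeasure f n).real A ≤ ε) {A : Set ℝ}
    (hAη : volume A < ENNReal.ofReal η) : ρ A ≤ ENNReal.ofReal ε := by
  obtain ⟨U, hAU, hU, hUη⟩ := A.exists_isOpen_lt_of_lt _ hAη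
  refine (measure_mono hAU).trans ?_
  have h1 := ProbabilityMeasure.le_liminf_measure_open_of_tendsto hf.tendsto_probabilityMeasure hU
  refine h1.trans (liminf_le_of_le (by isBoundedDefault) fun b hb => ?_)
  obtain ⟨n, hn⟩ := hb.exists
  refine hn.trans ?_
  have := hf.isProbabilityMeasure n
  have h2 := hη U hU.measurableSet hUη.le n
  change densityMeasure f n U ≤ _
  rw [← ofReal_measureReal]
  exact ENNReal.ofReal_le_ofReal h2

theorem DensityApprox.absolutelyContinuous [IsProbabilityMeasure ρ] (hf : DensityApprox ρ f)
    (hH : IsAdmissible H) (hE : EnergyBound H f c) : ρ ≪ volume := by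
  intro A hA
  refine le_antisymm (ENNReal.le_of_forall_pos_le_add fun ε hε _ => ?_) zero_le
  obtain ⟨η, hη, h⟩ := hf.equiintegrable hH hE (ε := ε) (by exact_mod_cast hε)
  have := hf.limit_equiintegrable h (A := A) (by simpa [hA] using hη)
  simpa using this

/-- A bounded function that is close to `0` off a set of small measure has a small integral. -/
theorem abs_integral_sub_le_of_measure_le {ν : Measure ℝ} [IsProbabilityMeasure ν]
    {φ g : ℝ → ℝ} (hφ : Measurable φ) (hg : Measurable g) {M ε : ℝ}
    (hφM : ∀ x, |φ x| ≤ M) (hgM : ∀ x, |g x| ≤ M) (hM : 0 ≤ M)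
    (hν : ν.real {x | ε ≤ |φ x - g x|} ≤ ε) (hε : 0 ≤ ε) :
    |∫ x, φ x ∂ν - ∫ x, g x ∂ν| ≤ ε + 2 * M * ε := by
  have hφi : Integrable φ ν := Integrable.of_bound hφ.aestronglyMeasurable M (ae_of_all _ hφM)
  have hgi : Integrable g ν := Integrable.of_bound hg.aestronglyMeasurable M (ae_of_all _ hgM)
  set A := {x | ε ≤ |φ x - g x|} with hA
  have hAm : MeasurableSet A := measurableSet_le measurable_const (hφ.sub hg).abs
  rw [← integral_sub hφi hgi]
  calc |∫ x, (φ x - g x) ∂ν| ≤ ∫ x, |φ x - g x| ∂ν := abs_integral_le_integral_abs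
    _ ≤ ∫ x, (ε + A.indicator (fun _ => 2 * M) x) ∂ν := by
        refine integral_mono (hφi.sub hgi).abs
          ((integrable_const _).add ((integrable_const _).indicator hAm)) fun x => ?_
        by_cases hx : x ∈ A
        · simp only [hx, Set.indicator_of_mem]
          have := abs_sub (φ x) (g x)
          linarith [hφM x, hgM x]
        · simp only [hx, not_false_eq_true, Set.indicator_of_notMem, add_zero]
          exact (not_le.1 hx).le
    _ = ε + 2 * M * ν.real A := by
        rw [integral_add (integrable_const _) ((integrable_const _).indicator hAm),
          integral_indicator_const _ hAm]
        simp [mul_comm]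
    _ ≤ ε + 2 * M * ε := by gcongr

/-- Weak convergence only allows continuous test functions. Here φ is approximated in L¹ by a
continuous g, and Markov's inequality makes the set where they differ by ε small for Lebesgue
measure, hence uniformly small for all the measures and for ρ. -/
theorem DensityApprox.tendsto_bounded [IsProbabilityMeasure ρ] (hf : DensityApprox ρ f)
    (hH : IsAdmissible H) (hE : EnergyBound H f c) {φ : ℝ → ℝ} (hφ : Measurable φ)
    (hφi : Integrable φ) {M : ℝ} (hM : ∀ x, |φ x| ≤ M) :
    Tendsto (fun n => ∫ x, φ x * f n x) atTop (𝓝 (∫ x, φ x ∂ρ)) := by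
  have hM0 : 0 ≤ M := (abs_nonneg _).trans (hM 0)
  rw [Metric.tendsto_atTop]
  intro δ hδ
  -- Replacing φ by g' costs ε + 2Mε = δ/4, once for the approximating measure and once for ρ; weak
  -- convergence costs another δ/4.
  set ε := δ / (4 * (1 + 2 * M)) with hεdef
  have hε : 0 < ε := by positivity
  have hεδ : ε + 2 * M * ε = δ / 4 := by rw [hεdef]; field_simp
  obtain ⟨η, hη, hηA⟩ := hf.equiintegrable hH hE hε
  obtain ⟨g, -, hgφ, hgc, hgi⟩ :=
    hφi.exists_hasCompactSupport_integral_sub_le (ε := ε * (η / 2)) (by positivity)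
  -- Truncation at the bound of φ does not increase the distance to φ, and makes g' bounded by M.
  set g' : ℝ → ℝ := fun x => max (-M) (min M (g x)) with hg'
  have hg'c : Continuous g' := by fun_prop
  have hg'M : ∀ x, |g' x| ≤ M := fun x =>
    abs_le.2 ⟨le_max_left _ _, max_le (by linarith) (min_le_left _ _)⟩
  have hclose : ∀ x, |φ x - g' x| ≤ |φ x - g x| := by
    intro x
    have h1 := abs_le.1 (hM x)
    have h2 : φ x = max (-M) (min M (φ x)) := by rw [min_eq_right h1.2, max_eq_right h1.1]
    calc |φ x - g' x| = |max (-M) (min M (φ x)) - max (-M) (min M (g x))| := by rw [← h2]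
      _ ≤ |min M (φ x) - min M (g x)| := by
          simpa [max_comm] using abs_max_sub_max_le_abs (min M (φ x)) (min M (g x)) (-M)
      _ ≤ |φ x - g x| := by
          have := abs_min_sub_min_le_max M (φ x) M (g x)
          simpa using this
  set A := {x | ε ≤ |φ x - g' x|} with hA
  have hAm : MeasurableSet A := measurableSet_le measurable_const (hφ.sub hg'c.measurable).abs
  have hAvol : volume A < ENNReal.ofReal η := by
    have h1 : volume A ≤ volume {x | ε ≤ |φ x - g x|} :=
      measure_mono fun x hx => le_trans hx (hclose x)
    have h2 := mul_meas_ge_le_integral_of_nonneg (μ := volume) (f := fun x => |φ x - g x|)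
      (ae_of_all _ fun x => abs_nonneg _) (hφi.sub hgi).abs ε
    have h3 : volume.real {x | ε ≤ |φ x - g x|} ≤ η / 2 := by
      have := h2.trans hgφ
      exact le_of_mul_le_mul_left this hε
    have hfin : volume {x | ε ≤ |φ x - g x|} ≠ ∞ :=
      ((hφi.sub hgi).abs.measure_ge_lt_top hε).ne
    refine h1.trans_lt ?_
    rw [← ofReal_measureReal hfin]
    exact (ENNReal.ofReal_lt_ofReal_iff hη).2 (by linarith)
  have hρA : ρ.real A ≤ ε := by
    rw [measureReal_def]
    exact ENNReal.toReal_le_of_le_ofReal hε.le (hf.limit_equiintegrable hηA hAvol)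
  have hweak : Tendsto (fun n => ∫ x, g' x ∂densityMeasure f n) atTop (𝓝 (∫ x, g' x ∂ρ)) :=
    ProbabilityMeasure.tendsto_iff_forall_integral_tendsto.1 hf.tendsto_probabilityMeasure
      (BoundedContinuousFunction.ofNormedAddCommGroup g' hg'c M hg'M)
  obtain ⟨n₀, hn₀⟩ := Metric.tendsto_atTop.1 hweak (δ / 4) (by positivity)
  refine ⟨n₀, fun n hn => ?_⟩
  have := hf.isProbabilityMeasure n
  rw [← hf.integral_densityMeasure]
  have e1 := abs_le.1 (abs_integral_sub_le_of_measure_le hφ hg'c.measurable hM hg'M hM0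
    (hηA A hAm hAvol.le n) hε.le)
  have e2 := abs_le.1 (abs_integral_sub_le_of_measure_le hφ hg'c.measurable hM hg'M hM0 hρA hε.le)
  have e3 := abs_lt.1 (Real.dist_eq _ _ ▸ hn₀ n hn)
  rw [Real.dist_eq, abs_lt]
  constructor <;> linarith [e1.1, e1.2, e2.1, e2.2, e3.1, e3.2]

end

section

variable {H : ℝ → ℝ} {ρ : Measure ℝ} {f : ℕ → ℝ → ℝ} {c : ℝ}

/-- The Lebesgue density of `ρ`, with real values. -/
noncomputable def density (ρ : Measure ℝ) (x : ℝ) : ℝ := (ρ.rnDeriv volume x).toReal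

theorem measurable_density (ρ : Measure ℝ) : Measurable (density ρ) :=
  (Measure.measurable_rnDeriv _ _).ennreal_toReal

theorem density_nonneg (ρ : Measure ℝ) (x : ℝ) : 0 ≤ density ρ x := ENNReal.toReal_nonneg

theorem integral_mul_density [IsFiniteMeasure ρ] (hac : ρ ≪ volume) (φ : ℝ → ℝ) :
    ∫ x, φ x * density ρ x = ∫ x, φ x ∂ρ := by
  rw [← integral_rnDeriv_smul hac]
  simp [density, mul_comm]

theorem integrable_mul_density [IsFiniteMeasure ρ] (hac : ρ ≪ volume) {φ : ℝ → ℝ}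
    (hφ : Integrable φ ρ) : Integrable fun x => φ x * density ρ x := by
  simpa [density, mul_comm] using (integrable_rnDeriv_smul_iff hac).2 hφ

theorem integrable_density (ρ : Measure ℝ) [IsFiniteMeasure ρ] : Integrable (density ρ) :=
  Measure.integrable_toReal_rnDeriv

/-! ### The continuum energy as an integral -/

theorem IsAdmissible.lintegral_neg_lt_top [IsFiniteMeasure ρ] (hH : IsAdmissible H)
    (hac : ρ ≪ volume) (hρ : Integrable (fun x => |x|) ρ) :
    ∫⁻ x, ENNReal.ofReal (-H (density ρ x)) < ∞ := by
  have hi : Integrable fun x => |x| * density ρ x + Real.exp (-|x|) :=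
    (integrable_mul_density hac hρ).add integrable_exp_neg_abs
  refine lt_of_le_of_lt (lintegral_mono fun x => ENNReal.ofReal_le_ofReal ?_) hi.lintegral_lt_top
  have := hH.lower _ |x| (density_nonneg ρ x) (abs_nonneg x)
  linarith

theorem IsAdmissible.continuumEnergy_line_of_integrable (hac : ρ ≪ volume)
    (hi : Integrable fun x => H (density ρ x)) :
    continuumEnergy H .line ρ = ((∫ x, H (density ρ x) : ℝ) : EReal) := by
  rw [continuumEnergy, if_pos hac, integral_eq_lintegral_pos_part_sub_lintegral_neg_part hi]
  have h1 : ∫⁻ x, ENNReal.ofReal (H (density ρ x)) ≠ ∞ := hi.lintegral_lt_top.ne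
  have h2 : ∫⁻ x, ENNReal.ofReal (-H (density ρ x)) ≠ ∞ := hi.neg.lintegral_lt_top.ne
  rw [EReal.coe_sub, EReal.coe_ennreal_toReal h1, EReal.coe_ennreal_toReal h2]
  simp [Domain.carrier, density]

/-- The negative part always has finite integral by `lower`, so integrability can only fail through
the positive part, and then the difference is ⊤ minus a finite number. -/
theorem IsAdmissible.continuumEnergy_line_eq_top [IsFiniteMeasure ρ] (hH : IsAdmissible H)
    (hρ : Integrable (fun x => |x|) ρ)
    (h : ¬ (ρ ≪ volume ∧ Integrable fun x => H (density ρ x))) :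
    continuumEnergy H .line ρ = ⊤ := by
  by_cases hac : ρ ≪ volume
  · have hneg := hH.lintegral_neg_lt_top hac hρ
    have hm : Measurable fun x => H (density ρ x) :=
      hH.measurable_comp (measurable_density ρ) (density_nonneg ρ)
    have hpos : ∫⁻ x, ENNReal.ofReal (H (density ρ x)) = ∞ := by
      by_contra hne
      refine h ⟨hac, hm.aestronglyMeasurable, ?_⟩
      rw [hasFiniteIntegral_iff_enorm]
      calc ∫⁻ x, ‖H (density ρ x)‖ₑ
          ≤ ∫⁻ x, (ENNReal.ofReal (H (density ρ x)) + ENNReal.ofReal (-H (density ρ x))) := by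
            refine lintegral_mono fun x => ?_
            rw [Real.enorm_eq_ofReal_abs]
            rcases abs_cases (H (density ρ x)) with h | h <;> rw [h.1] <;> simp
        _ = _ := lintegral_add_left hm.ennreal_ofReal _
        _ < ∞ := ENNReal.add_lt_top.2 ⟨lt_top_iff_ne_top.2 hne, hneg⟩
    rw [continuumEnergy, if_pos hac]
    simp only [Domain.carrier, Measure.restrict_univ]
    change ((∫⁻ x, ENNReal.ofReal (H (density ρ x)) : ℝ≥0∞) : EReal) -
      ((∫⁻ x, ENNReal.ofReal (-H (density ρ x)) : ℝ≥0∞) : EReal) = ⊤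
    rw [hpos, EReal.coe_ennreal_top, EReal.top_sub]
    simpa using hneg.ne
  · rw [continuumEnergy, if_neg hac]

theorem Domain.measurableSet_carrier (D : Domain) : MeasurableSet D.carrier := by
  cases D with
  | line => exact .univ
  | interval ℓ hℓ => exact measurableSet_Icc

/-- Densities vanish outside of the domain, so that the energy is an integral over the line. -/
theorem IsAdmissible.continuumEnergy_eq_line [IsFiniteMeasure ρ] (hH : IsAdmissible H)
    (D : Domain) (hD : ρ D.carrierᶜ = 0) :
    continuumEnergy H D ρ = continuumEnergy H .line ρ := by
  by_cases hac : ρ ≪ volume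
  · have hz : ∀ᵐ x, x ∈ D.carrierᶜ → ρ.rnDeriv volume x = 0 := by
      have h1 : ∫⁻ x in D.carrierᶜ, ρ.rnDeriv volume x = 0 := by
        rw [Measure.setLIntegral_rnDeriv hac, hD]
      rw [lintegral_eq_zero_iff (Measure.measurable_rnDeriv _ _),
        EventuallyEq, ae_restrict_iff' D.measurableSet_carrier.compl] at h1
      exact h1
    have key : ∀ G : ℝ → ℝ≥0∞, G 0 = 0 → ∫⁻ x in D.carrier, G (ρ.rnDeriv volume x).toReal =
        ∫⁻ x, G (ρ.rnDeriv volume x).toReal := by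
      intro G hG
      rw [← lintegral_add_compl (μ := volume) (fun x => G (ρ.rnDeriv volume x).toReal)
        D.measurableSet_carrier]
      have h0 : ∫⁻ x in D.carrierᶜ, G (ρ.rnDeriv volume x).toReal = ∫⁻ x in D.carrierᶜ, 0 :=
        setLIntegral_congr_fun_ae D.measurableSet_carrier.compl <| by
          filter_upwards [hz] with x hx hxD
          simp [hx hxD, hG]
      rw [h0, lintegral_zero, add_zero]
    simp only [continuumEnergy, if_pos hac]
    rw [key (fun s => ENNReal.ofReal (H s)) (by simp [hH.zero]),
      key (fun s => ENNReal.ofReal (-H s)) (by simp [hH.zero])]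
    simp [Domain.carrier]
  · simp only [continuumEnergy, if_neg hac]

/-! ### The lower bound -/

/-- The region where a density is bounded and bounded away from zero, in a bounded window. -/
def core (g : ℝ → ℝ) (k : ℕ) : Set ℝ :=
  {x | g x ∈ Set.Icc ((k : ℝ) + 1)⁻¹ (k + 1) ∧ |x| ≤ k + 1}

theorem measurableSet_core {g : ℝ → ℝ} (hg : Measurable g) (k : ℕ) : MeasurableSet (core g k) :=
  (hg measurableSet_Icc).inter (measurableSet_le measurable_id.abs measurable_const)

theorem volume_core_lt_top (g : ℝ → ℝ) (k : ℕ) : volume (core g k) < ∞ := by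
  refine (measure_mono (t := Metric.closedBall 0 (k + 1)) fun x hx => ?_).trans_lt
    measure_closedBall_lt_top
  simpa using hx.2

theorem aecover_core {g : ℝ → ℝ} (hg : Measurable g) :
    AECover (volume.restrict {x | 0 < g x}) atTop (core g) where
  ae_eventually_mem := by
    rw [ae_restrict_iff' (measurableSet_lt measurable_const hg)]
    refine ae_of_all _ fun x (hx : 0 < g x) => ?_
    filter_upwards [tendsto_natCast_atTop_atTop.eventually_ge_atTop (g x),
      tendsto_natCast_atTop_atTop.eventually_ge_atTop |x|,
      tendsto_natCast_atTop_atTop.eventually_ge_atTop (g x)⁻¹] with k h1 h2 h3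
    refine ⟨⟨?_, by linarith⟩, by linarith⟩
    rw [inv_le_comm₀ (by positivity) hx]
    linarith
  measurableSet := measurableSet_core hg

/-- The derivative of H may blow up at 0, as the logarithm does. On the core the density stays in a
compact subset of (0, ∞). -/
theorem exists_bound_on_core {ψ : ℝ → ℝ} (hψ : ContinuousOn ψ (Set.Ioi 0)) (g : ℝ → ℝ) (k : ℕ) :
    ∃ B : ℝ, 0 ≤ B ∧ ∀ x ∈ core g k, |ψ (g x)| ≤ B := by
  have hpos : (0 : ℝ) < ((k : ℝ) + 1)⁻¹ := by positivity
  obtain ⟨B, hB⟩ := isCompact_Icc.exists_bound_of_continuousOn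
    (hψ.mono fun x (hx : x ∈ Set.Icc ((k : ℝ) + 1)⁻¹ (k + 1)) => lt_of_lt_of_le hpos hx.1)
  exact ⟨max B 0, le_max_right _ _, fun x hx => le_max_of_le_left (hB _ hx.1)⟩

theorem integrableOn_core {g φ : ℝ → ℝ} (hg : Measurable g) (hφ : Measurable φ) {k : ℕ} {B : ℝ}
    (hB : ∀ x ∈ core g k, |φ x| ≤ B) : IntegrableOn φ (core g k) :=
  IntegrableOn.of_bound (volume_core_lt_top g k) hφ.aestronglyMeasurable B
    ((ae_restrict_iff' (measurableSet_core hg k)).2 (ae_of_all _ hB))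

/-- On the core A, H(f n) lies above the tangent of H at g, which is affine in f n with bounded
measurable coefficients, so its integral passes to the limit. Off the core the integrand H(f n) +
(|x|+m) f n + exp(-|x|-m) is non-negative and is dropped. The weight |x| + m passes to the limit on
the right as well. -/
theorem DensityApprox.core_energy_le [IsProbabilityMeasure ρ] (hf : DensityApprox ρ f)
    (hH : IsAdmissible H) (hE : EnergyBound H f c) (hρ : Integrable (fun x => |x|) ρ)
    (k m : ℕ) :
    ∫ x in core (density ρ) k, (H (density ρ x) + (|x| + m) * density ρ x) ≤
      c + (∫ x, (|x| + m) * density ρ x) + Real.exp (-m) * ∫ x : ℝ, Real.exp (-|x|) := by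
  have hac := hf.absolutelyContinuous hH hE
  set g := density ρ with hg
  set A := core g k with hA
  have hgm : Measurable g := measurable_density ρ
  have hg0 : ∀ x, 0 ≤ g x := density_nonneg ρ
  have hAm : MeasurableSet A := measurableSet_core hgm k
  have hgpos : ∀ x ∈ A, 0 < g x := fun x hx =>
    lt_of_lt_of_le (by positivity) (show ((k : ℝ) + 1)⁻¹ ≤ g x from hx.1.1)
  have hdm : Measurable fun x => deriv H (g x) := (measurable_deriv H).comp hgm
  have hHm : Measurable fun x => H (g x) := hH.measurable_comp hgm hg0
  obtain ⟨B₁, hB₁0, hB₁⟩ := exists_bound_on_core hH.continuousOn_deriv g k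
  obtain ⟨B₂, hB₂0, hB₂⟩ := exists_bound_on_core
    (hH.contDiffOn.continuousOn.sub (hH.continuousOn_deriv.mul continuousOn_id)) g k
  simp only [id_eq, Pi.sub_apply, Pi.mul_apply] at hB₂
  set φ₀ : ℝ → ℝ := fun x => deriv H (g x) + (|x| + m) with hφ₀
  have hφ₀m : Measurable φ₀ := hdm.add (measurable_id.abs.add_const _)
  have hφ₀B : ∀ x ∈ A, |φ₀ x| ≤ B₁ + (k + 1 + m) := fun x hx => by
    refine (abs_add_le _ _).trans (add_le_add (hB₁ x hx) ?_)
    rw [abs_of_nonneg (by positivity)]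
    have := hx.2
    linarith
  set φ : ℝ → ℝ := A.indicator φ₀ with hφ
  have hφm : Measurable φ := hφ₀m.indicator hAm
  have hφB : ∀ x, |φ x| ≤ B₁ + (k + 1 + m) := fun x => by
    by_cases hx : x ∈ A
    · simpa [hφ, hx] using hφ₀B x hx
    · simp only [hφ, hx, not_false_eq_true, Set.indicator_of_notMem, abs_zero]
      positivity
  have hφi : Integrable φ := (integrable_indicator_iff hAm).2 (integrableOn_core hgm hφ₀m hφ₀B)
  -- The intercept of the tangent at g; its slope, together with the weight, is `φ₀`.
  set ψ : ℝ → ℝ := fun x => H (g x) - deriv H (g x) * g x with hψ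
  have hψi : IntegrableOn ψ A :=
    integrableOn_core hgm (hHm.sub (hdm.mul hgm)) fun x hx => hB₂ x hx
  have hlim := hf.tendsto_bounded hH hE hφm hφi hφB
  have hlimabs := hf.tendsto_lipschitz _ 1 lipschitzWith_one_norm
  simp only [Real.norm_eq_abs] at hlimabs
  set W := ∫ x : ℝ, Real.exp (-|x|) with hW
  have hn : ∀ n, (∫ x in A, ψ x) + ∫ x, φ x * f n x ≤
      c + ((∫ x, |x| * f n x) + m) + Real.exp (-m) * W := by
    intro n
    have i1 : Integrable (fun x => |x| * f n x + m * f n x) :=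
      (hf.integrable_abs n).add ((hf.integrable n).const_mul _)
    have i2 : Integrable (fun x => H (f n x) + (|x| * f n x + m * f n x)) :=
      (hE.integrable n).add i1
    have i3 : Integrable (fun x : ℝ => Real.exp (-m) * Real.exp (-|x|)) :=
      integrable_exp_neg_abs.const_mul _
    have i4 : Integrable (fun x => φ x * f n x) := by
      refine (hf.integrable n).bdd_mul (c := B₁ + (k + 1 + m)) hφm.aestronglyMeasurable ?_
      exact ae_of_all _ hφB
    have hrhs : ∫ x, (H (f n x) + (|x| * f n x + m * f n x) +
        Real.exp (-m) * Real.exp (-|x|)) ≤ c + ((∫ x, |x| * f n x) + m) + Real.exp (-m) * W := by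
      rw [integral_add i2 i3, integral_add (hE.integrable n) i1,
        integral_add (hf.integrable_abs n) ((hf.integrable n).const_mul _), integral_const_mul,
        integral_const_mul, hf.integral_eq n, mul_one]
      linarith [hE.integral_le n]
    refine le_trans ?_ hrhs
    rw [← integral_indicator hAm, ← integral_add (hψi.integrable_indicator hAm) i4]
    refine integral_mono ((hψi.integrable_indicator hAm).add i4) (i2.add i3) fun x => ?_
    have hexp : Real.exp (-m) * Real.exp (-|x|) = Real.exp (-(|x| + m)) := by
      rw [← Real.exp_add]; ring_nf
    simp only [hexp]
    by_cases hx : x ∈ A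
    · simp only [hφ, hx, Set.indicator_of_mem, hψ, hφ₀]
      have := hH.tangent_le (hgpos x hx) (hf.nonneg n x)
      have := Real.exp_pos (-(|x| + m))
      linarith
    · simp only [hφ, hx, not_false_eq_true, Set.indicator_of_notMem, zero_mul, add_zero]
      have := hH.lower (f n x) (|x| + m) (hf.nonneg n x) (by positivity)
      linarith
  have hfinal := le_of_tendsto_of_tendsto' (hlim.const_add (∫ x in A, ψ x))
    (((hlimabs.add_const (m : ℝ)).const_add c).add_const (Real.exp (-m) * W)) hn
  have e1 : ∫ x, (|x| + m) * g x = ∫ x, |x| ∂ρ + m := by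
    rw [hg, integral_mul_density hac, integral_add hρ (integrable_const _)]
    simp
  have e2 : ∫ x, φ x ∂ρ = ∫ x in A, φ₀ x * g x := by
    rw [← integral_mul_density hac, ← integral_indicator hAm]
    refine integral_congr_ae (ae_of_all _ fun x => ?_)
    by_cases hx : x ∈ A <;> simp [hφ, hx, hg]
  have i5 : IntegrableOn (fun x => φ₀ x * g x) A := by
    refine integrableOn_core (φ := fun x => φ₀ x * g x) hgm (hφ₀m.mul hgm) (B := (B₁ + (k + 1 + m)) * (k + 1)) fun x hx => ?_
    rw [abs_mul, abs_of_nonneg (hg0 x)]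
    exact mul_le_mul (hφ₀B x hx) hx.1.2 (hg0 x) (by positivity)
  have e3 : ∫ x in A, (H (g x) + (|x| + m) * g x) =
      (∫ x in A, ψ x) + ∫ x in A, φ₀ x * g x := by
    rw [← integral_add hψi i5]
    refine integral_congr_ae (ae_of_all _ fun x => ?_)
    simp only [hψ, hφ₀]
    ring
  rw [e3, e1, ← e2]
  linarith

/-- Two limits of the core estimate: k → ∞ exhausts {g > 0}, off which H(g) = 0, and then m → ∞
removes the error exp(-m) W. -/
theorem DensityApprox.continuumEnergy_le [IsProbabilityMeasure ρ] (hf : DensityApprox ρ f)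
    (hH : IsAdmissible H) (hE : EnergyBound H f c) (hρ : Integrable (fun x => |x|) ρ) :
    continuumEnergy H .line ρ ≤ c := by
  have hac := hf.absolutelyContinuous hH hE
  set g := density ρ with hg
  have hgm : Measurable g := measurable_density ρ
  have hg0 : ∀ x, 0 ≤ g x := density_nonneg ρ
  have hHm : Measurable fun x => H (g x) := hH.measurable_comp hgm hg0
  set S := {x | 0 < g x} with hS
  have hcov : AECover (volume.restrict S) atTop (core g) := aecover_core hgm
  have hcoreS : ∀ k, core g k ⊆ S := fun k x hx =>
    lt_of_lt_of_le (by positivity) (show ((k : ℝ) + 1)⁻¹ ≤ g x from hx.1.1)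
  have hres : ∀ k, (volume.restrict S).restrict (core g k) = volume.restrict (core g k) := by
    intro k
    rw [Measure.restrict_restrict (measurableSet_core hgm k),
      Set.inter_eq_self_of_subset_left (hcoreS k)]
  set W := ∫ x : ℝ, Real.exp (-|x|) with hW
  have hw : ∀ m : ℕ, Integrable fun x => (|x| + m) * g x := fun m =>
    integrable_mul_density hac (hρ.add (integrable_const _))
  have hHcore : ∀ k, IntegrableOn (fun x => H (g x)) (core g k) := fun k => by
    obtain ⟨B, -, hB⟩ := exists_bound_on_core hH.contDiffOn.continuousOn g k
    exact integrableOn_core hgm hHm hB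
  have hsupp : Function.support (fun x => H (g x)) ⊆ S := by
    intro x hx
    by_contra h
    have : g x = 0 := le_antisymm (not_lt.1 h) (hg0 x)
    simp [this, hH.zero] at hx
  have hsuppw : ∀ m : ℕ, Function.support (fun x => (|x| + m) * g x) ⊆ S := by
    intro m x hx
    by_contra h
    have : g x = 0 := le_antisymm (not_lt.1 h) (hg0 x)
    simp [this] at hx
  have hHS : IntegrableOn (fun x => H (g x)) S := by
    -- Integrability of H(g) comes first, from m = 0: with exp(-|x|) added the integrand is
    -- non-negative, and its integrals over the cores are bounded.
    have h1 : Integrable (fun x => H (g x) + (|x| + (0 : ℕ)) * g x + Real.exp (-|x|))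
        (volume.restrict S) := by
      refine hcov.integrable_of_integral_bounded_of_nonneg_ae
        (c + (∫ x, (|x| + (0 : ℕ)) * g x) + Real.exp (-(0 : ℕ)) * W + W) (fun k => ?_)
        (ae_of_all _ fun x => ?_) (Eventually.of_forall fun k => ?_)
      · rw [IntegrableOn, hres]
        exact ((hHcore k).add (hw 0).integrableOn).add integrable_exp_neg_abs.integrableOn
      · have := hH.lower _ |x| (hg0 x) (abs_nonneg x)
        simpa using this
      · rw [hres]
        have i1 : IntegrableOn (fun x => H (g x) + (|x| + (0 : ℕ)) * g x) (core g k) :=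
          (hHcore k).add (hw 0).integrableOn
        rw [integral_add i1 integrable_exp_neg_abs.integrableOn]
        refine add_le_add (hf.core_energy_le hH hE hρ k 0) ?_
        exact setIntegral_le_integral integrable_exp_neg_abs
          (ae_of_all _ fun x => (Real.exp_pos _).le)
    have h2 := (h1.sub (hw 0).integrableOn).sub integrable_exp_neg_abs.integrableOn
    refine h2.congr (ae_of_all _ fun x => ?_)
    simp only [Pi.sub_apply]
    ring
  have hHi : Integrable fun x => H (g x) :=
    (integrableOn_iff_integrable_of_support_subset hsupp).1 hHS
  rw [IsAdmissible.continuumEnergy_line_of_integrable hac hHi, EReal.coe_le_coe_iff]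
  have hm : ∀ m : ℕ, ∫ x, H (g x) ≤ c + Real.exp (-m) * W := by
    intro m
    have i1 : Integrable (fun x => H (g x) + (|x| + m) * g x) := hHi.add (hw m)
    have hl := hcov.integral_tendsto_of_countably_generated i1.integrableOn
    simp only [hres] at hl
    have h1 := le_of_tendsto' hl fun k => hf.core_energy_le hH hE hρ k m
    rw [integral_add hHS (hw m).integrableOn, setIntegral_eq_integral_of_forall_compl_eq_zero
      (fun x hx => Function.notMem_support.1 fun h => hx (hsupp h)),
      setIntegral_eq_integral_of_forall_compl_eq_zero
      (fun x hx => Function.notMem_support.1 fun h => hx (hsuppw m h))] at h1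
    linarith
  have hlim : Tendsto (fun m : ℕ => c + Real.exp (-m) * W) atTop (𝓝 (c + 0 * W)) :=
    ((Real.tendsto_exp_neg_atTop_nhds_zero.comp tendsto_natCast_atTop_atTop).mul_const W).const_add c
  simpa using ge_of_tendsto' hlim hm

end

/-! ### The radii of particles -/

section Radius

variable {D : Domain} {N : ℕ} {x : ℕ → ℝ}

theorem gap_eq_coe {i : ℕ} (h1 : 2 ≤ i) (h2 : i ≤ N) :
    gap D N x i = ((x i - x (i - 1) : ℝ) : EReal) := by
  simp only [gap, position]
  rw [if_neg (by omega), if_neg (by omega), if_neg (by omega), if_neg (by omega), EReal.coe_sub]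

theorem IsParticles.lt (hx : IsParticles D N x) {i j : ℕ} (hi : 1 ≤ i) (hij : i < j)
    (hj : j ≤ N) : x i < x j :=
  hx.1 ⟨hi, by omega⟩ ⟨by omega, hj⟩ hij

/-- A particle on the boundary has the reflection of its neighbour as fictitious neighbour, which
repeats the first genuine gap; otherwise the gap is infinite. In both cases the minimum is the
genuine gap. -/
theorem IsParticles.gap_one (hx : IsParticles D N x) (hN : 2 ≤ N) :
    gap D N x 1 = ⊤ ∨ gap D N x 1 = ((x 2 - x 1 : ℝ) : EReal) := by
  simp only [gap, position]
  rw [if_neg (by omega), if_neg (by omega), if_pos trivial]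
  cases D with
  | line => left; simp [leftGhost]
  | interval ℓ hℓ =>
    simp only [leftGhost]
    split_ifs with h
    · left; simp
    · right
      have h1 : x 1 ∈ Set.Icc (-ℓ) ℓ := hx.2 1 ⟨le_rfl, by omega⟩
      have h2 : x 2 ∈ Set.Icc (-ℓ) ℓ := hx.2 2 ⟨by omega, hN⟩
      have h12 := hx.lt le_rfl one_lt_two hN
      have : x 1 = -ℓ := le_antisymm
        (not_lt.1 fun h3 => h ⟨h3, h12.trans_le h2.2⟩) h1.1
      rw [← EReal.coe_sub, this]
      congr 1
      ring

theorem IsParticles.gap_last (hx : IsParticles D N x) (hN : 2 ≤ N) :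
    gap D N x (N + 1) = ⊤ ∨ gap D N x (N + 1) = ((x N - x (N - 1) : ℝ) : EReal) := by
  simp only [gap, position]
  rw [if_neg (by omega), if_pos trivial, if_neg (by omega), if_neg (by omega), Nat.add_sub_cancel]
  cases D with
  | line => left; simp [rightGhost]
  | interval ℓ hℓ =>
    simp only [rightGhost]
    split_ifs with h
    · left; simp
    · right
      have h1 : x N ∈ Set.Icc (-ℓ) ℓ := hx.2 N ⟨by omega, le_rfl⟩
      have h2 : x (N - 1) ∈ Set.Icc (-ℓ) ℓ := hx.2 (N - 1) ⟨by omega, by omega⟩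
      have h12 := hx.lt (i := N - 1) (j := N) (by omega) (by omega) le_rfl
      have : x N = ℓ := le_antisymm h1.2 (not_lt.1 fun h3 => h ⟨h2.1.trans_lt h12, h3⟩)
      rw [← EReal.coe_sub, this]
      congr 1
      ring

theorem IsParticles.radius_one (hx : IsParticles D N x) (hN : 2 ≤ N) :
    radius D N x 1 = x 2 - x 1 := by
  have h2 : gap D N x (1 + 1) = ((x 2 - x 1 : ℝ) : EReal) := gap_eq_coe le_rfl hN
  rcases hx.gap_one hN with h | h <;> simp only [radius, h, h2]
  · simp [-EReal.coe_sub]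
  · simp [-EReal.coe_sub]

theorem IsParticles.radius_last (hx : IsParticles D N x) (hN : 2 ≤ N) :
    radius D N x N = x N - x (N - 1) := by
  have h2 : gap D N x N = ((x N - x (N - 1) : ℝ) : EReal) := gap_eq_coe hN le_rfl
  rcases hx.gap_last hN with h | h <;> simp only [radius, h, h2]
  · simp [-EReal.coe_sub]
  · simp [-EReal.coe_sub]

theorem radius_interior {i : ℕ} (h1 : 2 ≤ i) (h2 : i + 1 ≤ N) :
    radius D N x i = min (x i - x (i - 1)) (x (i + 1) - x i) := by
  rw [radius, gap_eq_coe h1 (by omega), gap_eq_coe (by omega) h2, Nat.add_sub_cancel,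
    ← EReal.coe_strictMono.monotone.map_min, EReal.toReal_coe]

theorem IsParticles.radius_le_left (hx : IsParticles D N x) {i : ℕ} (h1 : 2 ≤ i) (h2 : i ≤ N) :
    radius D N x i ≤ x i - x (i - 1) := by
  rcases h2.eq_or_lt with rfl | h
  · exact (hx.radius_last h1).le
  · rw [radius_interior h1 h]
    exact min_le_left _ _

theorem IsParticles.radius_le_right (hx : IsParticles D N x) {i : ℕ} (h1 : 1 ≤ i)
    (h2 : i + 1 ≤ N) : radius D N x i ≤ x (i + 1) - x i := by
  rcases h1.eq_or_lt with rfl | h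
  · exact (hx.radius_one h2).le
  · rw [radius_interior h h2]
    exact min_le_right _ _

theorem IsParticles.radius_cases (hx : IsParticles D N x) (hN : 2 ≤ N) {i : ℕ} (h1 : 1 ≤ i)
    (h2 : i ≤ N) : (2 ≤ i ∧ radius D N x i = x i - x (i - 1)) ∨
      (i + 1 ≤ N ∧ radius D N x i = x (i + 1) - x i) := by
  rcases h1.eq_or_lt with rfl | h
  · exact .inr ⟨hN, hx.radius_one hN⟩
  · rcases h2.eq_or_lt with rfl | h'
    · exact .inl ⟨h, hx.radius_last hN⟩
    · rw [radius_interior h h']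
      rcases min_choice (x i - x (i - 1)) (x (i + 1) - x i) with e | e
      · exact .inl ⟨h, e⟩
      · exact .inr ⟨h', e⟩

theorem IsParticles.radius_pos (hx : IsParticles D N x) (hN : 2 ≤ N) {i : ℕ} (h1 : 1 ≤ i)
    (h2 : i ≤ N) : 0 < radius D N x i := by
  rcases hx.radius_cases hN h1 h2 with ⟨h, e⟩ | ⟨h, e⟩ <;> rw [e, sub_pos]
  · exact hx.lt (by omega) (by omega) h2
  · exact hx.lt h1 (by omega) h

/-- Each radius is at most the gap on its left and these telescope. The first particle has no left
gap and uses x 2 - x 1 a second time, whence the factor 2. -/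
theorem IsParticles.sum_radius_le (hx : IsParticles D N x) (hN : 2 ≤ N) :
    ∑ i ∈ Finset.Icc 1 N, radius D N x i ≤ 2 * (x N - x 1) := by
  have key : ∀ n, 1 ≤ n → n ≤ N →
      ∑ i ∈ Finset.Icc 1 n, radius D N x i ≤ (x 2 - x 1) + (x n - x 1) := by
    intro n hn
    induction n, hn using Nat.le_induction with
    | base => intro _; simp [hx.radius_one hN]
    | succ n hn ih =>
      intro h
      rw [Finset.sum_Icc_succ_top (by omega)]
      have h1 := ih (by omega)
      have h2 := hx.radius_le_left (i := n + 1) (by omega) h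
      rw [Nat.add_sub_cancel] at h2
      linarith
  have h1 := key N (by omega) le_rfl
  have h2 : x 2 ≤ x N := hx.1.monotoneOn ⟨by omega, hN⟩ ⟨by omega, le_rfl⟩ hN
  linarith

/-- The balls of diameters `r i` around the particles are pairwise disjoint. -/
theorem IsParticles.disjoint_balls (hx : IsParticles D N x) {i j : ℕ} (hi : i ∈ Finset.Icc 1 N)
    (hj : j ∈ Finset.Icc 1 N) (hij : i ≠ j) :
    Disjoint (Set.Ioo (x i - radius D N x i / 2) (x i + radius D N x i / 2))
      (Set.Ioo (x j - radius D N x j / 2) (x j + radius D N x j / 2)) := by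
  wlog h : i < j generalizing i j
  · exact (this hj hi hij.symm (by omega)).symm
  rw [Finset.mem_Icc] at hi hj
  -- Both radii are at most x j - x i, so the half-radii fit between the two particles.
  have h1 := hx.radius_le_right hi.1 (by omega)
  have h2 := hx.radius_le_left (i := j) (by omega) hj.2
  have h3 : x (i + 1) ≤ x j := hx.1.monotoneOn ⟨by omega, by omega⟩ ⟨by omega, hj.2⟩ h
  have h4 : x i ≤ x (j - 1) := hx.1.monotoneOn ⟨by omega, by omega⟩ ⟨by omega, by omega⟩ (by omega)
  rw [Set.disjoint_left]
  rintro y ⟨-, hy1⟩ ⟨hy2, -⟩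
  linarith

end Radius

/-! ### Piecewise constant densities -/

/-- By disjointness at most one term is non-zero at a given point, and G(0) = 0 handles the points
outside all the sets. -/
theorem comp_sum_indicator {α ι : Type*} {s : Finset ι} {B : ι → Set α} {a : ι → ℝ} {G : ℝ → ℝ}
    (hG : G 0 = 0) (hB : ∀ i ∈ s, ∀ j ∈ s, i ≠ j → Disjoint (B i) (B j)) (y : α) :
    G (∑ i ∈ s, (B i).indicator (fun _ => a i) y) =
      ∑ i ∈ s, (B i).indicator (fun _ => G (a i)) y := by
  by_cases h : ∃ i ∈ s, y ∈ B i
  · obtain ⟨i, hi, hy⟩ := h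
    have hne : ∀ j ∈ s, j ≠ i → y ∉ B j := fun j hj hji hyj =>
      Set.disjoint_left.1 (hB j hj i hi hji) hyj hy
    rw [Finset.sum_eq_single_of_mem i hi fun j hj hji => Set.indicator_of_notMem (hne j hj hji) _,
      Finset.sum_eq_single_of_mem i hi fun j hj hji => Set.indicator_of_notMem (hne j hj hji) _,
      Set.indicator_of_mem hy, Set.indicator_of_mem hy]
  · push Not at h
    rw [Finset.sum_eq_zero fun i hi => Set.indicator_of_notMem (h i hi) _,
      Finset.sum_eq_zero fun i hi => Set.indicator_of_notMem (h i hi) _, hG]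

/-- The density that spreads the mass of each particle over the ball of diameter `r i`. -/
noncomputable def stepDensity (D : Domain) (N : ℕ) (x : ℕ → ℝ) (y : ℝ) : ℝ :=
  ∑ i ∈ Finset.Icc 1 N, (Set.Ioo (x i - radius D N x i / 2) (x i + radius D N x i / 2)).indicator
    (fun _ => ((N : ℝ) * radius D N x i)⁻¹) y

theorem integral_indicator_ball {a r b : ℝ} (hr : 0 < r) :
    ∫ y, (Set.Ioo (a - r / 2) (a + r / 2)).indicator (fun _ => b) y = r * b := by
  rw [integral_indicator_const _ measurableSet_Ioo, Real.volume_real_Ioo_of_le (by linarith),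
    smul_eq_mul]
  ring

theorem integrable_indicator_ball (a r b : ℝ) :
    Integrable ((Set.Ioo (a - r / 2) (a + r / 2)).indicator fun _ => b) :=
  (integrable_indicator_iff measurableSet_Ioo).2 (integrableOn_const (by simp))

section StepDensity

variable {D : Domain} {N : ℕ} {x : ℕ → ℝ} {H : ℝ → ℝ}

theorem measurable_stepDensity : Measurable (stepDensity D N x) :=
  Finset.measurable_fun_sum _ fun _ _ => measurable_const.indicator measurableSet_Ioo

theorem IsParticles.stepDensity_nonneg (hx : IsParticles D N x) (hN : 2 ≤ N) (y : ℝ) :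
    0 ≤ stepDensity D N x y := by
  refine Finset.sum_nonneg fun i hi => Set.indicator_nonneg (fun _ _ => ?_) _
  rw [Finset.mem_Icc] at hi
  have := hx.radius_pos hN hi.1 hi.2
  positivity

theorem IsParticles.comp_stepDensity (hx : IsParticles D N x) (hH : H 0 = 0) (y : ℝ) :
    H (stepDensity D N x y) = ∑ i ∈ Finset.Icc 1 N,
      (Set.Ioo (x i - radius D N x i / 2) (x i + radius D N x i / 2)).indicator
        (fun _ => H ((N : ℝ) * radius D N x i)⁻¹) y :=
  comp_sum_indicator hH (fun _ hi _ hj => hx.disjoint_balls hi hj) y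

theorem IsParticles.integrable_comp_stepDensity (hx : IsParticles D N x) (hH : H 0 = 0) :
    Integrable fun y => H (stepDensity D N x y) := by
  simp only [hx.comp_stepDensity hH]
  exact integrable_finsetSum _ fun i _ => integrable_indicator_ball _ _ _

/-- The energy of the spread particles is the discrete energy. -/
theorem IsParticles.integral_comp_stepDensity (hx : IsParticles D N x) (hN : 2 ≤ N)
    (hH : H 0 = 0) : ∫ y, H (stepDensity D N x y) = particleEnergy H D N x := by
  simp only [hx.comp_stepDensity hH]
  rw [integral_finsetSum _ fun i _ => integrable_indicator_ball _ _ _, particleEnergy,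
    Finset.mul_sum]
  refine Finset.sum_congr rfl fun i hi => ?_
  rw [Finset.mem_Icc] at hi
  have hN' : (N : ℝ) ≠ 0 := by positivity
  rw [integral_indicator_ball (hx.radius_pos hN hi.1 hi.2), hOf]
  field_simp

theorem IsParticles.integrable_stepDensity (hx : IsParticles D N x) :
    Integrable (stepDensity D N x) :=
  hx.integrable_comp_stepDensity (H := id) rfl

theorem IsParticles.integral_stepDensity (hx : IsParticles D N x) (hN : 2 ≤ N) :
    ∫ y, stepDensity D N x y = 1 := by
  -- The total mass is the energy for H = id, for which h is identically 1.
  have h := hx.integral_comp_stepDensity hN (H := id) rfl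
  simp only [id_eq] at h
  have hN' : (N : ℝ) ≠ 0 := by positivity
  rw [h, particleEnergy, Finset.sum_congr rfl (g := fun _ => (1 : ℝ))]
  · simp [hN']
  · intro i hi
    rw [Finset.mem_Icc] at hi
    have := (hx.radius_pos hN hi.1 hi.2).ne'
    simp only [hOf, id_eq]
    field_simp

theorem mul_stepDensity (φ : ℝ → ℝ) (y : ℝ) :
    φ y * stepDensity D N x y = ∑ i ∈ Finset.Icc 1 N, ((N : ℝ) * radius D N x i)⁻¹ *
      (Set.Ioo (x i - radius D N x i / 2) (x i + radius D N x i / 2)).indicator φ y := by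
  rw [stepDensity, Finset.mul_sum]
  refine Finset.sum_congr rfl fun i _ => ?_
  by_cases h : y ∈ Set.Ioo (x i - radius D N x i / 2) (x i + radius D N x i / 2) <;>
    simp [h, mul_comm]

theorem integrableOn_ball {φ : ℝ → ℝ} (hφ : Continuous φ) (a b : ℝ) :
    IntegrableOn φ (Set.Ioo a b) :=
  hφ.integrableOn_Icc.mono_set Set.Ioo_subset_Icc_self

theorem integrable_mul_stepDensity {φ : ℝ → ℝ} (hφ : Continuous φ) :
    Integrable fun y => φ y * stepDensity D N x y := by
  simp only [mul_stepDensity]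
  exact integrable_finsetSum _ fun i _ =>
    ((integrableOn_ball hφ _ _).integrable_indicator measurableSet_Ioo).const_mul _

/-- Spreading moves the mass 1/N of the particle i by at most its radius, at cost K r i / N; the
radii are then summed. -/
theorem IsParticles.abs_integral_mul_stepDensity_sub_le (hx : IsParticles D N x) (hN : 2 ≤ N)
    {φ : ℝ → ℝ} {K : NNReal} (hφ : LipschitzWith K φ) :
    |(∫ y, φ y * stepDensity D N x y) - (1 / (N : ℝ)) * ∑ i ∈ Finset.Icc 1 N, φ (x i)| ≤
      K * (2 * (x N - x 1) / N) := by
  have hN' : (0 : ℝ) < N := by positivity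
  simp only [mul_stepDensity]
  rw [integral_finsetSum _ fun i _ =>
    ((integrableOn_ball hφ.continuous _ _).integrable_indicator measurableSet_Ioo).const_mul _,
    Finset.mul_sum, ← Finset.sum_sub_distrib]
  have h1 : ∀ i ∈ Finset.Icc 1 N,
      |(∫ y, ((N : ℝ) * radius D N x i)⁻¹ *
        (Set.Ioo (x i - radius D N x i / 2) (x i + radius D N x i / 2)).indicator φ y) -
        1 / (N : ℝ) * φ (x i)| ≤ K * (radius D N x i / N) := by
    intro i hi
    rw [Finset.mem_Icc] at hi
    have hr := hx.radius_pos hN hi.1 hi.2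
    set r := radius D N x i with hrdef
    set B := Set.Ioo (x i - r / 2) (x i + r / 2) with hB
    have hvol : volume.real B = r := by
      rw [hB, Real.volume_real_Ioo_of_le (by linarith)]
      ring
    have e : (∫ y, ((N : ℝ) * r)⁻¹ * B.indicator φ y) - 1 / (N : ℝ) * φ (x i) =
        ((N : ℝ) * r)⁻¹ * ∫ y in B, (φ y - φ (x i)) := by
      rw [integral_const_mul, integral_indicator measurableSet_Ioo,
        integral_sub (integrableOn_ball hφ.continuous _ _) (integrableOn_const (by simp)),
        setIntegral_const, hvol, smul_eq_mul]
      field_simp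
    have h2 : ‖∫ y in B, (φ y - φ (x i))‖ ≤ (K * r) * volume.real B := by
      refine norm_setIntegral_le_of_norm_le_const (by simp [hB]) fun y hy => ?_
      rw [← dist_eq_norm]
      refine (hφ.dist_le_mul _ _).trans ?_
      gcongr
      rw [Real.dist_eq, abs_le]
      constructor <;> linarith [hy.1, hy.2]
    rw [e, abs_mul, abs_of_pos (by positivity)]
    rw [hvol, Real.norm_eq_abs] at h2
    calc ((N : ℝ) * r)⁻¹ * |∫ y in B, (φ y - φ (x i))| ≤ ((N : ℝ) * r)⁻¹ * (K * r * r) := by gcongr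
      _ = K * (r / N) := by field_simp
  calc _ ≤ ∑ i ∈ Finset.Icc 1 N, K * (radius D N x i / N) :=
        (Finset.abs_sum_le_sum_abs _ _).trans (Finset.sum_le_sum h1)
    _ = K * ((∑ i ∈ Finset.Icc 1 N, radius D N x i) / N) := by
        rw [← Finset.mul_sum, Finset.sum_div]
    _ ≤ _ := by
        gcongr
        exact hx.sum_radius_le hN

end StepDensity

/-! ### Consequences of closeness in the Wasserstein distance -/

theorem edist_sq_eq_ofReal (p : ℝ × ℝ) : edist p.1 p.2 ^ 2 = ENNReal.ofReal ((p.1 - p.2) ^ 2) := by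
  rw [edist_dist, Real.dist_eq, ← ENNReal.ofReal_pow (abs_nonneg _), sq_abs]

/-- The strict inequality provides an almost optimal plan, so no optimal plan is needed. -/
theorem exists_transportPlan {μ ν : Measure ℝ} {δ : ℝ} (hδ : 0 < δ)
    (h : d2 μ ν < ENNReal.ofReal δ) : ∃ γ ∈ transportPlans μ ν,
      Integrable (fun p : ℝ × ℝ => (p.1 - p.2) ^ 2) γ ∧ ∫ p, (p.1 - p.2) ^ 2 ∂γ ≤ δ ^ 2 := by
  simp only [d2, iInf_lt_iff] at h
  obtain ⟨γ, hγ, h⟩ := h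
  refine ⟨γ, hγ, ?_⟩
  simp only [edist_sq_eq_ofReal] at h
  have hlt : ∫⁻ p, ENNReal.ofReal ((p.1 - p.2) ^ 2) ∂γ < ENNReal.ofReal (δ ^ 2) := by
    have := ENNReal.rpow_lt_rpow h (z := 2) two_pos
    rw [← ENNReal.rpow_mul] at this
    norm_num at this
    rwa [← ENNReal.ofReal_pow hδ.le] at this
  have hm : Measurable fun p : ℝ × ℝ => (p.1 - p.2) ^ 2 := by fun_prop
  have hi : Integrable (fun p : ℝ × ℝ => (p.1 - p.2) ^ 2) γ := by
    refine ⟨hm.aestronglyMeasurable, ?_⟩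
    rw [hasFiniteIntegral_iff_ofReal (ae_of_all _ fun p => sq_nonneg _)]
    exact hlt.trans ENNReal.ofReal_lt_top
  refine ⟨hi, ?_⟩
  rw [← ofReal_integral_eq_lintegral_ofReal hi (ae_of_all _ fun p => sq_nonneg _)] at hlt
  exact ((ENNReal.ofReal_lt_ofReal_iff (by positivity)).1 hlt).le

section Plans

variable {μ ν : Measure ℝ} {γ : Measure (ℝ × ℝ)}

theorem isProbabilityMeasure_of_transportPlan [IsProbabilityMeasure μ]
    (hγ : γ ∈ transportPlans μ ν) : IsProbabilityMeasure γ := by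
  refine ⟨?_⟩
  have h : γ.map Prod.fst Set.univ = 1 := by rw [hγ.1, measure_univ]
  rwa [Measure.map_apply measurable_fst .univ] at h

theorem integral_fst_of_transportPlan (hγ : γ ∈ transportPlans μ ν) {φ : ℝ → ℝ}
    (hφ : Measurable φ) : ∫ p, φ p.1 ∂γ = ∫ x, φ x ∂μ := by
  rw [← hγ.1, integral_map measurable_fst.aemeasurable hφ.aestronglyMeasurable]

theorem integral_snd_of_transportPlan (hγ : γ ∈ transportPlans μ ν) {φ : ℝ → ℝ}
    (hφ : Measurable φ) : ∫ p, φ p.2 ∂γ = ∫ x, φ x ∂ν := by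
  rw [← hγ.2, integral_map measurable_snd.aemeasurable hφ.aestronglyMeasurable]

theorem integrable_fst_of_transportPlan (hγ : γ ∈ transportPlans μ ν) {φ : ℝ → ℝ}
    (hφ : Integrable φ μ) : Integrable (fun p => φ p.1) γ := by
  rw [← hγ.1] at hφ
  exact hφ.comp_measurable measurable_fst

theorem integrable_snd_of_transportPlan (hγ : γ ∈ transportPlans μ ν) {φ : ℝ → ℝ}
    (hφ : Integrable φ ν) : Integrable (fun p => φ p.2) γ := by
  rw [← hγ.2] at hφ
  exact hφ.comp_measurable measurable_snd

end Plans

variable {μ ν : Measure ℝ}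

theorem abs_integral_sub_le_of_d2_lt [IsProbabilityMeasure μ] {φ : ℝ → ℝ} {K : NNReal}
    (hφ : LipschitzWith K φ) (hμ : Integrable φ μ) (hν : Integrable φ ν) {δ : ℝ} (hδ : 0 < δ)
    (h : d2 μ ν < ENNReal.ofReal δ) : |∫ x, φ x ∂μ - ∫ x, φ x ∂ν| ≤ K * δ := by
  obtain ⟨γ, hγ, hi, hle⟩ := exists_transportPlan hδ h
  have := isProbabilityMeasure_of_transportPlan hγ
  rw [← integral_fst_of_transportPlan hγ hφ.continuous.measurable,
    ← integral_snd_of_transportPlan hγ hφ.continuous.measurable,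
    ← integral_sub (integrable_fst_of_transportPlan hγ hμ) (integrable_snd_of_transportPlan hγ hν)]
  -- The inequality |z| ≤ (z²/δ + δ)/2 replaces Cauchy–Schwarz.
  have hi' : Integrable (fun p : ℝ × ℝ => (K : ℝ) * (((p.1 - p.2) ^ 2 * δ⁻¹ + δ) * 2⁻¹)) γ :=
    (((hi.mul_const _).add (integrable_const _)).mul_const _).const_mul _
  calc |∫ p, (φ p.1 - φ p.2) ∂γ| ≤ ∫ p, |φ p.1 - φ p.2| ∂γ := abs_integral_le_integral_abs
    _ ≤ ∫ p, (K : ℝ) * (((p.1 - p.2) ^ 2 * δ⁻¹ + δ) * 2⁻¹) ∂γ := by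
        refine integral_mono ((integrable_fst_of_transportPlan hγ hμ).sub
          (integrable_snd_of_transportPlan hγ hν)).abs hi' fun p => ?_
        refine (Real.dist_eq _ _ ▸ hφ.dist_le_mul p.1 p.2).trans ?_
        gcongr
        rw [Real.dist_eq, ← sq_abs (p.1 - p.2)]
        field_simp
        nlinarith [sq_nonneg (|p.1 - p.2| - δ)]
    _ = K * (((∫ p, (p.1 - p.2) ^ 2 ∂γ) * δ⁻¹ + δ) * 2⁻¹) := by
        rw [integral_const_mul, integral_mul_const, integral_add (hi.mul_const _)
          (integrable_const _), integral_mul_const]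
        simp
    _ ≤ K * ((δ ^ 2 * δ⁻¹ + δ) * 2⁻¹) := by gcongr
    _ = K * δ := by field_simp; ring

theorem integral_sq_le_of_d2_lt [IsProbabilityMeasure μ] (hμ : Integrable (fun x => x ^ 2) μ)
    (hν : Integrable (fun x => x ^ 2) ν) {δ : ℝ} (hδ : 0 < δ) (h : d2 μ ν < ENNReal.ofReal δ) :
    ∫ x, x ^ 2 ∂μ ≤ 2 * δ ^ 2 + 2 * ∫ x, x ^ 2 ∂ν := by
  obtain ⟨γ, hγ, hi, hle⟩ := exists_transportPlan hδ h
  have hi2 : Integrable (fun p : ℝ × ℝ => p.2 ^ 2) γ := integrable_snd_of_transportPlan hγ hν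
  have hi1 : Integrable (fun p : ℝ × ℝ => p.1 ^ 2) γ := integrable_fst_of_transportPlan hγ hμ
  rw [← integral_fst_of_transportPlan hγ (φ := fun x => x ^ 2) (by fun_prop),
    ← integral_snd_of_transportPlan hγ (φ := fun x => x ^ 2) (by fun_prop)]
  calc ∫ p, p.1 ^ 2 ∂γ ≤ ∫ p, (2 * (p.1 - p.2) ^ 2 + 2 * p.2 ^ 2) ∂γ := by
        refine integral_mono hi1 ((hi.const_mul 2).add (hi2.const_mul 2)) fun p => ?_
        simp only
        nlinarith [sq_nonneg (p.1 - 2 * p.2)]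
    _ = 2 * (∫ p, (p.1 - p.2) ^ 2 ∂γ) + 2 * ∫ p, p.2 ^ 2 ∂γ := by
        rw [integral_add (hi.const_mul 2) (hi2.const_mul 2), integral_const_mul,
          integral_const_mul]
    _ ≤ _ := by gcongr

/-! ### Empirical measures -/

theorem integral_empirical (N : ℕ) (x : ℕ → ℝ) (φ : ℝ → ℝ) :
    ∫ y, φ y ∂empirical N x = 1 / (N : ℝ) * ∑ i ∈ Finset.Icc 1 N, φ (x i) := by
  rw [empirical, integral_smul_measure, integral_finsetSum_measure fun i _ =>
    integrable_dirac (by simp)]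
  simp

theorem integrable_empirical {N : ℕ} (hN : N ≠ 0) (x : ℕ → ℝ) (φ : ℝ → ℝ) :
    Integrable φ (empirical N x) := by
  refine Integrable.smul_measure ?_ (by simpa using hN)
  exact integrable_finsetSum_measure.2 fun i _ => integrable_dirac (by simp)

theorem integrable_sq_of_mem_P2 {D : Domain} {ρ : Measure ℝ} (hρ : ρ ∈ P2 D) :
    Integrable (fun x => x ^ 2) ρ := by
  refine ⟨by fun_prop, ?_⟩
  have := hρ.2.2
  simpa [hasFiniteIntegral_iff_enorm, enorm_pow] using this

theorem integrable_of_lipschitz {D : Domain} {ρ : Measure ℝ} (hρ : ρ ∈ P2 D) {φ : ℝ → ℝ}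
    {K : NNReal} (hφ : LipschitzWith K φ) : Integrable φ ρ := by
  have := hρ.1
  refine Integrable.mono' (g := fun x => |φ 0| + K * (x ^ 2 + 1))
    ((integrable_const _).add (((integrable_sq_of_mem_P2 hρ).add (integrable_const _)).const_mul _))
    hφ.continuous.aestronglyMeasurable (ae_of_all _ fun x => ?_)
  have h1 := hφ.dist_le_mul x 0
  rw [Real.dist_eq, Real.dist_eq, sub_zero] at h1
  have h2 : |x| ≤ x ^ 2 + 1 := by
    rw [← sq_abs]
    nlinarith [sq_nonneg (|x| - 1)]
  have h3 : |φ x| ≤ |φ 0| + |φ x - φ 0| := by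
    have := abs_add_le (φ 0) (φ x - φ 0)
    simpa using this
  have h4 : (K : ℝ) * |x| ≤ K * (x ^ 2 + 1) := by gcongr
  rw [Real.norm_eq_abs]
  linarith

theorem integrable_abs_of_mem_P2 {D : Domain} {ρ : Measure ℝ} (hρ : ρ ∈ P2 D) :
    Integrable (fun x => |x|) ρ :=
  integrable_of_lipschitz hρ lipschitzWith_one_norm

/-! ### The lower bound for particles -/

/-- If particles converge to `ρ`, so do the densities obtained by spreading them. -/
theorem densityApprox_stepDensity {D : Domain} {ρ : Measure ℝ} (hρ : ρ ∈ P2 D) {n : ℕ → ℕ}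
    (hn : Tendsto n atTop atTop) (hn2 : ∀ k, 2 ≤ n k) {x : ℕ → ℕ → ℝ}
    (hx : ∀ k, IsParticles D (n k) (x k)) (hP : ∀ k, empirical (n k) (x k) ∈ P2 D)
    (hd : Tendsto (fun k => d2 (empirical (n k) (x k)) ρ) atTop (𝓝 0)) :
    DensityApprox ρ fun k => stepDensity D (n k) (x k) where
  measurable k := measurable_stepDensity
  nonneg k y := (hx k).stepDensity_nonneg (hn2 k) y
  integrable k := (hx k).integrable_stepDensity
  integral_eq k := (hx k).integral_stepDensity (hn2 k)
  integrable_abs k := integrable_mul_stepDensity continuous_abs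
  tendsto_lipschitz φ K hφ := by
    have hnR : Tendsto (fun k => (n k : ℝ)) atTop atTop := tendsto_natCast_atTop_atTop.comp hn
    set B := 2 * (1 : ℝ) ^ 2 + 2 * ∫ x, x ^ 2 ∂ρ with hB
    -- A single particle has mass 1/N, so the second moment bound B gives x i² ≤ BN, that is |x i|/N
    -- ≤ √(B/N). B comes from comparison with ρ at distance below 1.
    have hspread : ∀ᶠ k in atTop,
        2 * (x k (n k) - x k 1) / (n k : ℝ) ≤ 4 * √(B / n k) := by
      filter_upwards [hd.eventually_lt_const (show (0 : ℝ≥0∞) < ENNReal.ofReal 1 by simp)] with k hk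
      have := (hP k).1
      have hpos : (0 : ℝ) < n k := by
        have := hn2 k
        positivity
      have h1 := integral_sq_le_of_d2_lt (integrable_sq_of_mem_P2 (hP k))
        (integrable_sq_of_mem_P2 hρ) one_pos hk
      rw [integral_empirical, ← hB] at h1
      have h2 : ∀ i ∈ Finset.Icc 1 (n k), |x k i / n k| ≤ √(B / n k) := by
        intro i hi
        have h3 : x k i ^ 2 ≤ ∑ j ∈ Finset.Icc 1 (n k), x k j ^ 2 :=
          Finset.single_le_sum (f := fun j => x k j ^ 2) (fun j _ => sq_nonneg _) hi
        refine Real.abs_le_sqrt ?_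
        rw [div_pow, div_le_div_iff₀ (by positivity) hpos]
        have h4 : ∑ j ∈ Finset.Icc 1 (n k), x k j ^ 2 ≤ B * n k := by
          rw [one_div, inv_mul_le_iff₀ hpos] at h1
          linarith
        nlinarith
      have h5 := (abs_le.1 (h2 (n k) (Finset.mem_Icc.2 ⟨by linarith [hn2 k], le_rfl⟩))).2
      have h6 := (abs_le.1 (h2 1 (Finset.mem_Icc.2 ⟨le_rfl, by linarith [hn2 k]⟩))).1
      have h7 : 2 * (x k (n k) - x k 1) / (n k : ℝ) = 2 * (x k (n k) / n k - x k 1 / n k) := by ring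
      rw [h7]
      linarith
    have hsqrt : Tendsto (fun k => 4 * √(B / n k)) atTop (𝓝 0) := by
      have := ((hnR.const_div_atTop B).sqrt).const_mul 4
      simpa using this
    rw [Metric.tendsto_atTop']
    intro ε hε
    have hKpos : (0 : ℝ) < K + 1 := by positivity
    set δ := ε / (4 * (K + 1)) with hδdef
    have hδ : 0 < δ := by positivity
    have hδ' : K * δ ≤ ε / 4 := by
      rw [hδdef, ← sub_nonneg]
      have : ε / 4 - K * (ε / (4 * (K + 1))) = ε / (4 * (K + 1)) := by field_simp; ring
      rw [this]
      positivity
    have hev := (hspread.and (hsqrt.eventually_lt_const hδ)).and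
      (hd.eventually_lt_const (show (0 : ℝ≥0∞) < ENNReal.ofReal δ by simpa using hδ))
    obtain ⟨k₀, hk₀⟩ := eventually_atTop.1 hev
    refine ⟨k₀, fun k hk => ?_⟩
    obtain ⟨⟨h1, h2⟩, h3⟩ := hk₀ k hk.le
    have := (hP k).1
    have e1 := (hx k).abs_integral_mul_stepDensity_sub_le (hn2 k) hφ
    have e2 := abs_integral_sub_le_of_d2_lt hφ (integrable_of_lipschitz (hP k) hφ)
      (integrable_of_lipschitz hρ hφ) hδ h3
    rw [integral_empirical] at e2
    have e3 : (K : ℝ) * (2 * (x k (n k) - x k 1) / n k) ≤ K * δ := by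
      gcongr
      exact h1.trans h2.le
    rw [Real.dist_eq]
    have e4 := abs_add_le ((∫ y, φ y * stepDensity D (n k) (x k) y) -
      1 / (n k : ℝ) * ∑ i ∈ Finset.Icc 1 (n k), φ (x k i))
      (1 / (n k : ℝ) * ∑ i ∈ Finset.Icc 1 (n k), φ (x k i) - ∫ x, φ x ∂ρ)
    rw [sub_add_sub_cancel] at e4
    linarith

/-- If the inequality failed, some real c would separate the two sides. Along a subsequence the
discrete energies lie below c, hence so do those of the spread densities, and semicontinuity gives
energy at most c for ρ. -/
theorem IsAdmissible.continuumEnergy_le_liminf {H : ℝ → ℝ} (hH : IsAdmissible H) {D : Domain}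
    {ρ : Measure ℝ} (hρ : ρ ∈ P2 D) {μ : ℕ → Measure ℝ}
    (hμ : ∀ N, 2 ≤ N → μ N ∈ atomicMeasures D N)
    (hd : Tendsto (fun N => d2 (μ N) ρ) atTop (𝓝 0)) :
    continuumEnergy H D ρ ≤ liminf (fun N => (discreteEnergy H D N (μ N) : EReal)) atTop := by
  by_contra hlt
  obtain ⟨c, hc1, hc2⟩ := EReal.lt_iff_exists_real_btwn.1 (not_le.1 hlt)
  have hfreq := frequently_lt_of_liminf_lt (by isBoundedDefault) hc1
  obtain ⟨n, hnmono, hn⟩ := extraction_of_frequently_atTop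
    (hfreq.and_eventually (eventually_ge_atTop 2))
  choose x hx hxμ using fun k => (hμ (n k) (hn k).2).2
  have hP : ∀ k, empirical (n k) (x k) ∈ P2 D := fun k => hxμ k ▸ (hμ (n k) (hn k).2).1
  have hdn : Tendsto (fun k => d2 (empirical (n k) (x k)) ρ) atTop (𝓝 0) := by
    simpa [← hxμ, Function.comp_def] using hd.comp hnmono.tendsto_atTop
  have hf := densityApprox_stepDensity hρ hnmono.tendsto_atTop (fun k => (hn k).2) hx hP hdn
  have hE : EnergyBound H (fun k => stepDensity D (n k) (x k)) c :=
    { integrable := fun k => (hx k).integrable_comp_stepDensity hH.zero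
      integral_le := fun k => by
        have h := (hn k).1
        rw [hxμ k, discreteEnergy_empirical H D (hn k).2 (hx k), EReal.coe_lt_coe_iff] at h
        rw [(hx k).integral_comp_stepDensity (hn k).2 hH.zero]
        exact h.le }
  have := hρ.1
  refine absurd (hf.continuumEnergy_le hH hE (integrable_abs_of_mem_P2 hρ)) (not_le.2 ?_)
  rwa [← hH.continuumEnergy_eq_line D hρ.2.1]

open ProbabilityTheory

/-! ### Quantile functions -/

/-- The quantile function of a probability measure on the line, of interest on `(0, 1)`. -/
noncomputable def quantile (ρ : Measure ℝ) (u : ℝ) : ℝ := sInf {x | u ≤ cdf ρ x}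

section Quantile

variable {ρ : Measure ℝ}

/-- The infimum defining the quantile is attained, by right continuity of the distribution function.
All properties of quantiles follow from this adjunction. -/
theorem quantile_le_iff {u : ℝ} (hu : u ∈ Set.Ioo (0 : ℝ) 1) (x : ℝ) :
    quantile ρ u ≤ x ↔ u ≤ cdf ρ x := by
  have hne : {x | u ≤ cdf ρ x}.Nonempty :=
    ((tendsto_cdf_atTop ρ).eventually_const_le hu.2).exists
  have hbdd : BddBelow {x | u ≤ cdf ρ x} := by
    obtain ⟨y, hy⟩ := ((tendsto_cdf_atBot ρ).eventually_lt_const hu.1).exists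
    refine ⟨y, fun x hx => not_lt.1 fun h => ?_⟩
    exact absurd (hx.trans (monotone_cdf ρ h.le)) (not_le.2 hy)
  refine ⟨fun h => ?_, fun h => csInf_le hbdd h⟩
  have hq : u ≤ cdf ρ (quantile ρ u) := by
    have hr := ((cdf ρ).right_continuous (quantile ρ u)).mono Set.Ioi_subset_Ici_self
    refine ge_of_tendsto hr (eventually_nhdsWithin_of_forall fun y hy => ?_)
    obtain ⟨z, hz, hzy⟩ := exists_lt_of_csInf_lt hne (Set.mem_Ioi.1 hy)
    exact le_trans hz (monotone_cdf ρ hzy.le)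
  exact hq.trans (monotone_cdf ρ h)

theorem le_cdf_quantile {u : ℝ} (hu : u ∈ Set.Ioo (0 : ℝ) 1) : u ≤ cdf ρ (quantile ρ u) :=
  (quantile_le_iff hu _).1 le_rfl

theorem monotoneOn_quantile (ρ : Measure ℝ) : MonotoneOn (quantile ρ) (Set.Ioo 0 1) :=
  fun _ hu _ hv huv => (quantile_le_iff hu _).2 (huv.trans (le_cdf_quantile hv))

theorem quantile_mem_carrier [IsProbabilityMeasure ρ] {D : Domain} (hD : ρ D.carrierᶜ = 0) {u : ℝ}
    (hu : u ∈ Set.Ioo (0 : ℝ) 1) : quantile ρ u ∈ D.carrier := by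
  cases D with
  | line => trivial
  | interval ℓ hℓ =>
    constructor
    · refine not_lt.1 fun h => absurd (le_cdf_quantile (ρ := ρ) hu) (not_le.2 ?_)
      have h0 : ρ (Set.Iic (quantile ρ u)) = 0 := measure_mono_null
        (t := (Set.Icc (-ℓ) ℓ)ᶜ)
        (fun x (hx : x ≤ _) hxD => absurd (hxD.1.trans hx) (not_le.2 h)) hD
      rw [cdf_eq_real, measureReal_def, h0]
      simpa using hu.1
    · rw [quantile_le_iff hu, cdf_eq_real]
      have h1 : ρ (Set.Iic ℓ) = 1 := by
        rw [prob_compl_eq_zero_iff measurableSet_Iic |>.symm]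
        exact measure_mono_null (t := (Set.Icc (-ℓ) ℓ)ᶜ) (fun x (hx : ¬ x ≤ ℓ) hxD => hx hxD.2) hD
      rw [measureReal_def, h1]
      simpa using hu.2.le

/-- Lebesgue measure on the unit interval. -/
noncomputable def unitMeasure : Measure ℝ := volume.restrict (Set.Ioo 0 1)

instance : IsProbabilityMeasure unitMeasure := ⟨by simp [unitMeasure]⟩

theorem ae_mem_unit : ∀ᵐ u ∂unitMeasure, u ∈ Set.Ioo (0 : ℝ) 1 :=
  ae_restrict_mem measurableSet_Ioo

theorem aemeasurable_quantile (ρ : Measure ℝ) : AEMeasurable (quantile ρ) unitMeasure :=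
  aemeasurable_restrict_of_monotoneOn measurableSet_Ioo (monotoneOn_quantile ρ)

theorem map_quantile [IsProbabilityMeasure ρ] : unitMeasure.map (quantile ρ) = ρ := by
  have := (Measure.isProbabilityMeasure_map_iff (aemeasurable_quantile ρ)).2
    (inferInstance : IsProbabilityMeasure unitMeasure)
  refine Measure.ext_of_Iic _ _ fun x => ?_
  rw [Measure.map_apply_of_aemeasurable (aemeasurable_quantile ρ) measurableSet_Iic,
    ← ofReal_cdf ρ x]
  have h1 : quantile ρ ⁻¹' Set.Iic x =ᵐ[unitMeasure] Set.Iic (cdf ρ x) := by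
    filter_upwards [ae_mem_unit] with u hu
    exact propext (quantile_le_iff hu x)
  rw [measure_congr h1, unitMeasure, Measure.restrict_congr_set Ioo_ae_eq_Ioc,
    Measure.restrict_apply measurableSet_Iic]
  have h2 : Set.Iic (cdf ρ x) ∩ Set.Ioc 0 1 = Set.Ioc 0 (cdf ρ x) := by
    ext u
    have := cdf_le_one ρ x
    constructor
    · rintro ⟨h, h'⟩; exact ⟨h'.1, h⟩
    · rintro h; exact ⟨h.2, h.1, h.2.trans this⟩
  rw [h2, Real.volume_Ioc, sub_zero]

theorem ae_continuousAt_quantile (ρ : Measure ℝ) :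
    ∀ᵐ u ∂unitMeasure, ContinuousAt (quantile ρ) u := by
  have hc := (monotoneOn_quantile ρ).countable_not_continuousWithinAt
  filter_upwards [ae_mem_unit, ae_restrict_of_ae (hc.ae_notMem volume)] with u hu hu'
  by_contra h
  exact hu' ⟨hu, fun hw => h (hw.continuousAt (isOpen_Ioo.mem_nhds hu))⟩

theorem integrable_quantile_comp [IsProbabilityMeasure ρ] {φ : ℝ → ℝ} (hφ : Integrable φ ρ) :
    Integrable (fun u => φ (quantile ρ u)) unitMeasure := by
  rw [← map_quantile (ρ := ρ)] at hφ
  exact hφ.comp_aemeasurable (aemeasurable_quantile ρ)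

theorem integral_quantile_comp [IsProbabilityMeasure ρ] {φ : ℝ → ℝ} (hφ : Measurable φ) :
    ∫ u, φ (quantile ρ u) ∂unitMeasure = ∫ x, φ x ∂ρ := by
  conv_rhs => rw [← map_quantile (ρ := ρ)]
  rw [integral_map (aemeasurable_quantile ρ) hφ.aestronglyMeasurable]

theorem ae_quantile [IsProbabilityMeasure ρ] {p : ℝ → Prop} (h : ∀ᵐ x ∂ρ, p x) :
    ∀ᵐ u ∂unitMeasure, p (quantile ρ u) := by
  rw [← map_quantile (ρ := ρ)] at h
  exact ae_of_ae_map (aemeasurable_quantile ρ) h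

/-- Strictly left of the quantile the distribution function is below u, and absolute continuity
excludes a jump there. -/
theorem cdf_quantile [IsProbabilityMeasure ρ] (hac : ρ ≪ volume) {u : ℝ}
    (hu : u ∈ Set.Ioo (0 : ℝ) 1) : cdf ρ (quantile ρ u) = u := by
  refine le_antisymm ?_ (le_cdf_quantile hu)
  have h0 : (cdf ρ).measure {quantile ρ u} = 0 := by
    rw [measure_cdf]
    exact hac Real.volume_singleton
  rw [StieltjesFunction.measure_singleton, ENNReal.ofReal_eq_zero, sub_nonpos] at h0
  refine h0.trans (le_of_tendsto ((monotone_cdf ρ).tendsto_leftLim _)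
    (eventually_nhdsWithin_of_forall fun y hy => ?_))
  exact (not_le.1 fun h => absurd ((quantile_le_iff hu y).2 h) (not_le.2 hy)).le

/-- The derivative of the quantile function of an absolutely continuous measure. -/
theorem ae_hasDerivAt_quantile [IsProbabilityMeasure ρ] (hac : ρ ≪ volume) :
    ∀ᵐ u ∂unitMeasure, 0 < density ρ (quantile ρ u) ∧
      HasDerivAt (quantile ρ) (density ρ (quantile ρ u))⁻¹ u := by
  -- Lebesgue differentiation holds a.e. for Lebesgue measure, hence ρ-a.e., and is pulled back to
  -- a.e. u because ρ is the image of the uniform measure. The quantile function is then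
  -- differentiated as a local right inverse of the distribution function.
  have h1 : ∀ᵐ x ∂ρ, HasDerivAt (cdf ρ) (density ρ x) x := by
    have := (cdf ρ).ae_hasDerivAt
    rw [measure_cdf] at this
    exact hac.ae_le this
  have h2 : ∀ᵐ x ∂ρ, 0 < density ρ x := by
    filter_upwards [Measure.rnDeriv_pos hac, hac.ae_le (Measure.rnDeriv_lt_top ρ volume)]
      with x hx hx'
    exact ENNReal.toReal_pos hx.ne' hx'.ne
  filter_upwards [ae_mem_unit, ae_continuousAt_quantile ρ, ae_quantile h1, ae_quantile h2]
    with u hu hc hd hpos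
  refine ⟨hpos, HasDerivAt.of_local_left_inverse hc hd hpos.ne' ?_⟩
  filter_upwards [isOpen_Ioo.mem_nhds hu] with v hv
  exact cdf_quantile hac hv

end Quantile

/-! ### Step functions on the unit interval -/

theorem ceil_mem_Icc {N : ℕ} {u : ℝ} (hN : 0 < N) (hu : u ∈ Set.Ioo (0 : ℝ) 1) :
    ⌈(N : ℝ) * u⌉₊ ∈ Finset.Icc 1 N := by
  have hN' : (0 : ℝ) < N := by exact_mod_cast hN
  rw [Finset.mem_Icc]
  refine ⟨Nat.one_le_ceil_iff.2 (mul_pos hN' hu.1), Nat.ceil_le.2 ?_⟩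
  nlinarith [hu.2]

/-- The ceiling of Nu indexes the cell ((i-1)/N, i/N] containing u. Averages over particles thus
become integrals over one fixed probability space. -/
theorem map_ceil_unitMeasure {N : ℕ} (hN : 0 < N) :
    unitMeasure.map (fun u => ⌈(N : ℝ) * u⌉₊) =
      (N : ℝ≥0∞)⁻¹ • ∑ i ∈ Finset.Icc 1 N, Measure.dirac i := by
  have hN' : (0 : ℝ) < N := by exact_mod_cast hN
  have hm : Measurable fun u : ℝ => ⌈(N : ℝ) * u⌉₊ := Nat.measurable_ceil.comp (by fun_prop)
  refine Measure.ext_of_singleton fun i => ?_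
  rw [Measure.map_apply hm (measurableSet_singleton i)]
  simp only [Measure.smul_apply, Measure.finsetSum_apply, smul_eq_mul,
    Measure.dirac_apply' _ (measurableSet_singleton i), Set.indicator_apply,
    Set.mem_singleton_iff, Pi.one_apply, Finset.sum_ite_eq']
  split_ifs with hi
  · rw [Finset.mem_Icc] at hi
    have hi0 : i ≠ 0 := by omega
    have hset : (fun u : ℝ => ⌈(N : ℝ) * u⌉₊) ⁻¹' {i} =
        Set.Ioc (((i - 1 : ℕ) : ℝ) / N) ((i : ℝ) / N) := by
      ext u
      simp only [Set.mem_preimage, Set.mem_singleton_iff, Nat.ceil_eq_iff hi0, Set.mem_Ioc]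
      rw [div_lt_iff₀ hN', le_div_iff₀ hN', mul_comm u]
    have hsub : Set.Ioc (((i - 1 : ℕ) : ℝ) / N) ((i : ℝ) / N) ⊆ Set.Ioc 0 1 := by
      refine Set.Ioc_subset_Ioc (by positivity) ?_
      rw [div_le_one hN']
      exact_mod_cast hi.2
    rw [hset, unitMeasure, Measure.restrict_congr_set Ioo_ae_eq_Ioc,
      Measure.restrict_apply measurableSet_Ioc, Set.inter_eq_self_of_subset_left hsub,
      Real.volume_Ioc, ← sub_div, Nat.cast_sub hi.1]
    simp [ENNReal.ofReal_inv_of_pos hN']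
  · rw [mul_zero]
    refine measure_mono_null (t := (Set.Ioo 0 1)ᶜ) (fun u hu hu' => hi ?_) ae_mem_unit
    have := ceil_mem_Icc hN hu'
    rwa [Set.mem_preimage.1 hu] at this

theorem measurable_step (N : ℕ) {α : Type*} [MeasurableSpace α] (a : ℕ → α) :
    Measurable fun u : ℝ => a ⌈(N : ℝ) * u⌉₊ :=
  (measurable_of_countable a).comp (Nat.measurable_ceil.comp (by fun_prop))

theorem lintegral_step {N : ℕ} (hN : 0 < N) (a : ℕ → ℝ≥0∞) :
    ∫⁻ u, a ⌈(N : ℝ) * u⌉₊ ∂unitMeasure = (N : ℝ≥0∞)⁻¹ * ∑ i ∈ Finset.Icc 1 N, a i := by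
  have hm : Measurable fun u : ℝ => ⌈(N : ℝ) * u⌉₊ := Nat.measurable_ceil.comp (by fun_prop)
  rw [← lintegral_map (measurable_of_countable a) hm, map_ceil_unitMeasure hN,
    lintegral_smul_measure, lintegral_finsetSum_measure]
  simp

theorem integrable_step {N : ℕ} (hN : 0 < N) (a : ℕ → ℝ) :
    Integrable (fun u => a ⌈(N : ℝ) * u⌉₊) unitMeasure := by
  have hm : Measurable fun u : ℝ => ⌈(N : ℝ) * u⌉₊ := Nat.measurable_ceil.comp (by fun_prop)
  refine Integrable.comp_measurable (f := fun u : ℝ => ⌈(N : ℝ) * u⌉₊) (g := a) ?_ hm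
  rw [map_ceil_unitMeasure hN]
  exact (integrable_finsetSum_measure.2 fun i _ => integrable_dirac (by simp)).smul_measure
    (by simpa using hN.ne')

theorem integral_step {N : ℕ} (hN : 0 < N) (a : ℕ → ℝ) :
    ∫ u, a ⌈(N : ℝ) * u⌉₊ ∂unitMeasure = 1 / (N : ℝ) * ∑ i ∈ Finset.Icc 1 N, a i := by
  have hm : Measurable fun u : ℝ => ⌈(N : ℝ) * u⌉₊ := Nat.measurable_ceil.comp (by fun_prop)
  rw [← integral_map hm.aemeasurable (measurable_of_countable a).aestronglyMeasurable,
    map_ceil_unitMeasure hN, integral_smul_measure,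
    integral_finsetSum_measure fun i _ => integrable_dirac (by simp)]
  simp

theorem map_step {N : ℕ} (hN : 0 < N) (x : ℕ → ℝ) :
    unitMeasure.map (fun u => x ⌈(N : ℝ) * u⌉₊) = empirical N x := by
  ext A hA
  rw [Measure.map_apply (measurable_step N x) hA,
    ← lintegral_indicator_one (measurable_step N x hA)]
  have := lintegral_step hN fun i => A.indicator 1 (x i)
  simp only [empirical, Measure.smul_apply, Measure.finsetSum_apply, smul_eq_mul,
    Measure.dirac_apply' _ hA]
  exact this

/-! ### Convergence of quantile particles -/

/-- The midpoint of the `i`-th of `N` cells of the unit interval. -/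
noncomputable def midpoint (N i : ℕ) : ℝ := (2 * (i : ℝ) - 1) / (2 * N)

theorem midpoint_mem {N i : ℕ} (hi : i ∈ Finset.Icc 1 N) : midpoint N i ∈ Set.Ioo (0 : ℝ) 1 := by
  rw [Finset.mem_Icc] at hi
  have h1 : (1 : ℝ) ≤ i := by exact_mod_cast hi.1
  have h2 : (i : ℝ) ≤ N := by exact_mod_cast hi.2
  constructor
  · exact div_pos (by linarith) (by linarith)
  · rw [midpoint, div_lt_one (by linarith)]
    linarith

theorem midpoint_lt {N i j : ℕ} (hN : 0 < N) (hij : i < j) : midpoint N i < midpoint N j := by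
  have h1 : (i : ℝ) < j := by exact_mod_cast hij
  have hN' : (0 : ℝ) < N := by exact_mod_cast hN
  unfold midpoint
  gcongr

theorem abs_midpoint_ceil_sub_le {N : ℕ} {u : ℝ} (hN : 0 < N) (hu : 0 < u) :
    |midpoint N ⌈(N : ℝ) * u⌉₊ - u| ≤ 1 / N := by
  have hN' : (0 : ℝ) < N := by exact_mod_cast hN
  have h1 := Nat.le_ceil ((N : ℝ) * u)
  have h2 := Nat.ceil_lt_add_one (mul_pos hN' hu).le
  have e : midpoint N ⌈(N : ℝ) * u⌉₊ - u = ((⌈(N : ℝ) * u⌉₊ : ℝ) - 1 / 2 - N * u) / N := by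
    unfold midpoint
    field_simp
  rw [e, abs_div, abs_of_pos hN']
  gcongr
  rw [abs_le]
  constructor <;> linarith

/-- Since quantiles are monotone, those at midpoints are sandwiched between the quantiles at u/2 and
(u+1)/2. This gives a square-integrable majorant independent of N, although quantiles may be
unbounded near 0 and 1. -/
theorem half_le_midpoint_ceil {N : ℕ} {u : ℝ} (hN : 0 < N) (hu : u ∈ Set.Ioo (0 : ℝ) 1) :
    1 / 2 * u ≤ midpoint N ⌈(N : ℝ) * u⌉₊ ∧
      midpoint N ⌈(N : ℝ) * u⌉₊ ≤ 1 / 2 * (u + 1) := by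
  have hN' : (0 : ℝ) < N := by exact_mod_cast hN
  have h1 := Nat.le_ceil ((N : ℝ) * u)
  have h2 := Nat.ceil_lt_add_one (mul_pos hN' hu.1).le
  have h3 := Finset.mem_Icc.1 (ceil_mem_Icc hN hu)
  have h4 : (1 : ℝ) ≤ ⌈(N : ℝ) * u⌉₊ := by exact_mod_cast h3.1
  have h5 : (⌈(N : ℝ) * u⌉₊ : ℝ) ≤ N := by exact_mod_cast h3.2
  unfold midpoint
  rw [le_div_iff₀ (by positivity), div_le_iff₀ (by positivity)]
  constructor <;> nlinarith

theorem integrable_comp_half {g : ℝ → ℝ} (hg : Integrable g unitMeasure) :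
    Integrable (fun u => g (1 / 2 * u)) unitMeasure ∧
      Integrable (fun u => g (1 / 2 * (u + 1))) unitMeasure := by
  have hg' : IntervalIntegrable g volume 0 1 :=
    (intervalIntegrable_iff_integrableOn_Ioo_of_le zero_le_one).2 hg
  have h1 := hg'.comp_mul_left (c := 1 / 2)
  have h2 := h1.comp_add_right 1
  norm_num at h1 h2
  constructor
  · refine (intervalIntegrable_iff_integrableOn_Ioo_of_le zero_le_one).1
      (h1.mono_set ?_)
    rw [Set.uIcc_of_le (by norm_num), Set.uIcc_of_le (by norm_num)]
    exact Set.Icc_subset_Icc le_rfl (by norm_num)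
  · refine (intervalIntegrable_iff_integrableOn_Ioo_of_le zero_le_one).1
      (h2.mono_set ?_)
    rw [Set.uIcc_of_le (by norm_num), Set.uIcc_of_le (by norm_num)]
    exact Set.Icc_subset_Icc (by norm_num) (by norm_num)

/-- The particles and ρ are coupled through the common variable u. -/
theorem d2_empirical_le {ρ : Measure ℝ} [IsProbabilityMeasure ρ] {N : ℕ} (hN : 0 < N)
    (x : ℕ → ℝ) : d2 (empirical N x) ρ ≤
      (∫⁻ u, ENNReal.ofReal ((x ⌈(N : ℝ) * u⌉₊ - quantile ρ u) ^ 2) ∂unitMeasure) ^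
        (1 / 2 : ℝ) := by
  have hm : AEMeasurable (fun u => (x ⌈(N : ℝ) * u⌉₊, quantile ρ u)) unitMeasure :=
    (measurable_step N x).aemeasurable.prodMk (aemeasurable_quantile ρ)
  have hγ : unitMeasure.map (fun u => (x ⌈(N : ℝ) * u⌉₊, quantile ρ u)) ∈
      transportPlans (empirical N x) ρ := by
    constructor
    · rw [AEMeasurable.map_map_of_aemeasurable measurable_fst.aemeasurable hm, ← map_step hN]
      rfl
    · rw [AEMeasurable.map_map_of_aemeasurable measurable_snd.aemeasurable hm]
      exact map_quantile
  refine (iInf₂_le _ hγ).trans_eq ?_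
  simp only [edist_sq_eq_ofReal]
  rw [lintegral_map' (by fun_prop) hm]

/-- Particles close to the quantiles of `ρ` converge to `ρ` in the Wasserstein distance. -/
theorem tendsto_d2_empirical {ρ : Measure ℝ} [IsProbabilityMeasure ρ]
    (hρ : Integrable (fun x => x ^ 2) ρ) {x : ℕ → ℕ → ℝ}
    (hx : ∀ N, ∀ i ∈ Finset.Icc 1 N,
      |x N i - quantile ρ (midpoint N i)| ≤ (|quantile ρ (midpoint N i)| + 1) / N) :
    Tendsto (fun N => d2 (empirical N (x N)) ρ) atTop (𝓝 0) := by
  set X := quantile ρ with hX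
  have hX2 : Integrable (fun u => X u ^ 2) unitMeasure :=
    integrable_quantile_comp (φ := fun x => x ^ 2) hρ
  obtain ⟨hi1, hi2⟩ := integrable_comp_half hX2
  -- With c the midpoint and y the particle, |y| ≤ 2|X c| + 1, so (y - X u)² ≤ 2y² + 2(X u)² ≤ 16(X
  -- c)² + 4 + 2(X u)².
  set b : ℝ → ℝ := fun u => 16 * (X (1 / 2 * u) ^ 2 + X (1 / 2 * (u + 1)) ^ 2 + 1 + X u ^ 2)
    with hb
  have hbi : Integrable b unitMeasure :=
    (((hi1.add hi2).add (integrable_const 1)).add hX2).const_mul 16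
  have hlim : Tendsto (fun N : ℕ => ∫⁻ u, ENNReal.ofReal ((x N ⌈(N : ℝ) * u⌉₊ - X u) ^ 2)
      ∂unitMeasure) atTop (𝓝 (∫⁻ _, 0 ∂unitMeasure)) := by
    -- The domination must hold for every index, and there are no cells for N = 0.
    rw [← tendsto_add_atTop_iff_nat 1]
    refine tendsto_lintegral_of_dominated_convergence' (fun u => ENNReal.ofReal (b u))
      (fun N => ?_) (fun N => ?_) hbi.lintegral_lt_top.ne ?_
    · exact (((measurable_step (N + 1) (x (N + 1))).aemeasurable.sub
        (aemeasurable_quantile ρ)).pow_const 2).ennreal_ofReal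
    · filter_upwards [ae_mem_unit] with u hu
      refine ENNReal.ofReal_le_ofReal ?_
      have hi := ceil_mem_Icc N.succ_pos hu
      have hxi := hx (N + 1) _ hi
      obtain ⟨hc1, hc2⟩ := half_le_midpoint_ceil N.succ_pos hu
      have hm := midpoint_mem hi
      rw [Nat.succ_eq_add_one] at *
      set c := midpoint (N + 1) ⌈((N + 1 : ℕ) : ℝ) * u⌉₊
      set y := x (N + 1) ⌈((N + 1 : ℕ) : ℝ) * u⌉₊
      have hl : X (1 / 2 * u) ≤ X c :=
        monotoneOn_quantile ρ ⟨by linarith [hu.1], by linarith [hu.2]⟩ hm hc1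
      have hr : X c ≤ X (1 / 2 * (u + 1)) :=
        monotoneOn_quantile ρ hm ⟨by linarith [hu.1], by linarith [hu.2]⟩ hc2
      have hsq : X c ^ 2 ≤ X (1 / 2 * u) ^ 2 + X (1 / 2 * (u + 1)) ^ 2 := by
        rcases le_total 0 (X c) with h | h <;> nlinarith
      have hy : |y| ≤ 2 * |X c| + 1 := by
        have h1 : (|X c| + 1) / ((N + 1 : ℕ) : ℝ) ≤ |X c| + 1 :=
          div_le_self (by positivity) (by exact_mod_cast N.succ_pos)
        have h2 := abs_add_le (X c) (y - X c)
        rw [add_sub_cancel] at h2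
        linarith
      have hy2 : y ^ 2 ≤ (2 * |X c| + 1) ^ 2 := by
        rw [← sq_abs y]
        gcongr
      simp only [hb]
      nlinarith [sq_nonneg (y + X u), sq_nonneg (2 * |X c| - 1), sq_abs (X c), sq_nonneg (X u)]
    · filter_upwards [ae_mem_unit, ae_continuousAt_quantile ρ] with u hu hc
      have hmid : Tendsto (fun N : ℕ => midpoint N ⌈(N : ℝ) * u⌉₊) atTop (𝓝 u) := by
        rw [tendsto_iff_norm_sub_tendsto_zero]
        refine squeeze_zero' (Eventually.of_forall fun _ => norm_nonneg _) ?_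
          tendsto_one_div_atTop_nhds_zero_nat
        filter_upwards [eventually_gt_atTop 0] with N hN
        exact abs_midpoint_ceil_sub_le hN hu.1
      have hXc : Tendsto (fun N : ℕ => X (midpoint N ⌈(N : ℝ) * u⌉₊)) atTop (𝓝 (X u)) :=
        hc.tendsto.comp hmid
      have hdiff : Tendsto (fun N : ℕ => x N ⌈(N : ℝ) * u⌉₊ - X (midpoint N ⌈(N : ℝ) * u⌉₊))
          atTop (𝓝 0) := by
        rw [tendsto_zero_iff_norm_tendsto_zero]
        refine squeeze_zero' (Eventually.of_forall fun _ => norm_nonneg _) ?_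
          ((hXc.abs.add_const 1).div_atTop tendsto_natCast_atTop_atTop)
        filter_upwards [eventually_gt_atTop 0] with N hN
        exact hx N _ (ceil_mem_Icc hN hu)
      have h := (((hdiff.add hXc).sub_const (X u)).pow 2)
      simp only [sub_add_cancel, zero_add, sub_self, ne_eq, OfNat.ofNat_ne_zero,
        not_false_eq_true, zero_pow] at h
      have h' := ENNReal.tendsto_ofReal h
      rw [ENNReal.ofReal_zero] at h'
      exact (tendsto_add_atTop_iff_nat 1).2 h'
  rw [lintegral_zero] at hlim
  have hlim' := hlim.ennrpow_const (1 / 2 : ℝ)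
  rw [ENNReal.zero_rpow_of_pos (by norm_num)] at hlim'
  refine tendsto_of_tendsto_of_tendsto_of_le_of_le' tendsto_const_nhds hlim'
    (Eventually.of_forall fun _ => zero_le) ?_
  filter_upwards [eventually_gt_atTop 0] with N hN
  exact d2_empirical_le hN (x N)

/-! ### Two limit lemmas for the recovery sequence. -/

/-- A reverse Fatou lemma with variable majorants whose integrals do not exceed that of the
limit. -/
theorem eventually_integral_lt_of_le_majorant {α : Type*} [MeasurableSpace α] {μ : Measure α}
    {ψ G : ℕ → α → ℝ} {g G₀ : α → ℝ} (hψ : ∀ n, Integrable (ψ n) μ) (hG : ∀ n, Integrable (G n) μ)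
    (hg : Integrable g μ) (hG₀ : Integrable G₀ μ) (hle : ∀ n, ∀ᵐ a ∂μ, ψ n a ≤ G n a)
    (hψg : ∀ᵐ a ∂μ, Tendsto (fun n => ψ n a) atTop (𝓝 (g a)))
    (hGG : ∀ᵐ a ∂μ, Tendsto (fun n => G n a) atTop (𝓝 (G₀ a)))
    (hint : ∀ n, ∫ a, G n a ∂μ ≤ ∫ a, G₀ a ∂μ) {ε : ℝ} (hε : 0 < ε) :
    ∀ᶠ n in atTop, ∫ a, ψ n a ∂μ < ∫ a, g a ∂μ + ε := by
  by_contra hcon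
  have hfreq : ∃ᶠ n in atTop, ∫ a, g a ∂μ + ε ≤ ∫ a, ψ n a ∂μ := by
    simpa [Filter.Frequently] using hcon
  have hterm : ∀ n, ∫⁻ a, ENNReal.ofReal (G n a - ψ n a) ∂μ =
      ENNReal.ofReal (∫ a, G n a ∂μ - ∫ a, ψ n a ∂μ) := by
    intro n
    rw [← integral_sub (hG n) (hψ n)]
    refine (ofReal_integral_eq_lintegral_ofReal ((hG n).sub (hψ n)) ?_).symm
    filter_upwards [hle n] with a ha
    exact sub_nonneg.2 ha
  have hlim : ∫⁻ a, ENNReal.ofReal (G₀ a - g a) ∂μ =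
      ENNReal.ofReal (∫ a, G₀ a ∂μ - ∫ a, g a ∂μ) := by
    rw [← integral_sub hG₀ hg]
    refine (ofReal_integral_eq_lintegral_ofReal (hG₀.sub hg) ?_).symm
    filter_upwards [ae_all_iff.2 hle, hψg, hGG] with a h1 h2 h3
    exact sub_nonneg.2 (le_of_tendsto_of_tendsto' h2 h3 h1)
  -- Fatou for the non-negative functions G n - ψ n. If the integral of ψ n exceeded the claimed
  -- bound infinitely often, the liminf on the right would be at least ε too small.
  have hfatou := lintegral_liminf_le' (μ := μ) (u := atTop) (f := fun n a => ENNReal.ofReal (G n a - ψ n a))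
    fun n => ((hG n).sub (hψ n)).aestronglyMeasurable.aemeasurable.ennreal_ofReal
  have hleft : ∫⁻ a, liminf (fun n => ENNReal.ofReal (G n a - ψ n a)) atTop ∂μ =
      ∫⁻ a, ENNReal.ofReal (G₀ a - g a) ∂μ := by
    refine lintegral_congr_ae ?_
    filter_upwards [hψg, hGG] with a h2 h3
    exact (ENNReal.tendsto_ofReal (h3.sub h2)).liminf_eq
  rw [hleft, hlim] at hfatou
  simp only [hterm] at hfatou
  have hbound : liminf (fun n => ENNReal.ofReal (∫ a, G n a ∂μ - ∫ a, ψ n a ∂μ)) atTop ≤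
      ENNReal.ofReal (∫ a, G₀ a ∂μ - ∫ a, g a ∂μ - ε) := by
    refine liminf_le_of_frequently_le' (hfreq.mono fun n hn => ENNReal.ofReal_le_ofReal ?_)
    linarith [hint n]
  -- One such index shows that the right-hand side is non-negative, so that `ENNReal.ofReal` can be
  -- removed.
  obtain ⟨n, hn⟩ := hfreq.exists
  have h0 : ∫ a, ψ n a ∂μ ≤ ∫ a, G n a ∂μ := integral_mono_ae (hψ n) (hG n) (hle n)
  have h1 := (ENNReal.ofReal_le_ofReal_iff (by linarith [hint n])).1 (hfatou.trans hbound)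
  linarith

/-- Difference quotients over intervals of length `1 / N` at distance of order `1 / N`. -/
theorem tendsto_mul_sub_of_hasDerivAt {X : ℝ → ℝ} {d u C : ℝ} (hX : HasDerivAt X d u)
    {a b : ℕ → ℝ} (ha : ∀ᶠ N : ℕ in atTop, |a N - u| ≤ C / N)
    (hb : ∀ᶠ N : ℕ in atTop, |b N - u| ≤ C / N)
    (hab : ∀ᶠ N : ℕ in atTop, b N - a N = 1 / N) :
    Tendsto (fun N : ℕ => (N : ℝ) * (X (b N) - X (a N))) atTop (𝓝 d) := by
  have key : ∀ {a : ℕ → ℝ}, (∀ᶠ N : ℕ in atTop, |a N - u| ≤ C / N) →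
      (fun N => X (a N) - X u - (a N - u) * d) =o[atTop] fun N : ℕ => 1 / (N : ℝ) := by
    intro a ha
    have hau : Tendsto a atTop (𝓝 u) := by
      rw [tendsto_iff_norm_sub_tendsto_zero]
      exact squeeze_zero' (Eventually.of_forall fun _ => norm_nonneg _) ha
        (tendsto_const_div_atTop_nhds_zero_nat C)
    have h1 := (hasDerivAt_iff_isLittleO.1 hX).comp_tendsto hau
    refine h1.trans_isBigO (Asymptotics.IsBigO.of_bound C ?_)
    filter_upwards [ha] with N hN
    rw [Function.comp_apply, Real.norm_eq_abs, Real.norm_eq_abs,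
      abs_of_nonneg (show (0 : ℝ) ≤ 1 / N by positivity)]
    exact hN.trans_eq (by ring)
  have h2 := ((key hb).sub (key ha)).tendsto_div_nhds_zero.add_const d
  rw [zero_add] at h2
  refine h2.congr' ?_
  filter_upwards [hab, eventually_gt_atTop 0] with N hN hN0
  have hN' : (N : ℝ) ≠ 0 := by positivity
  have e : X (b N) - X u - (b N - u) * d - (X (a N) - X u - (a N - u) * d) =
      X (b N) - X (a N) - (1 / N) * d := by
    rw [← hN]
    ring
  rw [e]
  field_simp
  ring

/-! ### Membership in the class of atomic measures -/

theorem empirical_mem_atomicMeasures {D : Domain} {N : ℕ} {x : ℕ → ℝ} (hN : 2 ≤ N)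
    (hx : IsParticles D N x) : empirical N x ∈ atomicMeasures D N := by
  have hN0 : 0 < N := by omega
  refine ⟨⟨?_, ?_, ?_⟩, x, hx, rfl⟩
  · rw [← map_step hN0]
    exact (Measure.isProbabilityMeasure_map_iff (measurable_step N x).aemeasurable).2 inferInstance
  · rw [← map_step hN0, Measure.map_apply (measurable_step N x) D.measurableSet_carrier.compl]
    refine measure_mono_null (t := (Set.Ioo 0 1)ᶜ) (fun u hu hu' => hu ?_) ae_mem_unit
    exact hx.2 _ (by simpa using Finset.mem_Icc.1 (ceil_mem_Icc hN0 hu'))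
  · have := (integrable_empirical hN0.ne' x fun y => y ^ 2).2
    simpa [hasFiniteIntegral_iff_enorm, enorm_pow] using this

/-! ### Approximation of arbitrary measures -/

/-- Atoms of ρ make quantiles coincide. A convex combination with equally spaced points, of weight
1/N, separates them, stays in the convex domain, and moves each particle by at most (|quantile| +
1)/N. -/
theorem exists_atomic_approx {D : Domain} {ρ : Measure ℝ} (hρ : ρ ∈ P2 D) :
    ∃ x : ℕ → ℕ → ℝ, (∀ N, 2 ≤ N → IsParticles D N (x N)) ∧
      Tendsto (fun N => d2 (empirical N (x N)) ρ) atTop (𝓝 0) := by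
  have := hρ.1
  obtain ⟨m, hm0, hm1, hmD⟩ : ∃ m : ℝ, 0 < m ∧ m ≤ 1 ∧ Set.Icc 0 m ⊆ D.carrier := by
    cases D with
    | line => exact ⟨1, one_pos, le_rfl, Set.subset_univ _⟩
    | interval ℓ hℓ =>
      exact ⟨min 1 ℓ, lt_min one_pos hℓ, min_le_left _ _,
        Set.Icc_subset_Icc (by linarith) (min_le_right _ _)⟩
  have hconv : Convex ℝ D.carrier := by
    cases D with
    | line => exact convex_univ
    | interval ℓ hℓ => exact convex_Icc _ _
  have hy : ∀ {N i : ℕ}, i ∈ Finset.Icc 1 N → m * i / N ∈ Set.Icc 0 m := by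
    intro N i hi
    rw [Finset.mem_Icc] at hi
    have hN : (0 : ℝ) < N := by exact_mod_cast (by omega : 0 < N)
    refine ⟨by positivity, ?_⟩
    rw [div_le_iff₀ hN]
    gcongr
    exact hi.2
  refine ⟨fun N i => (1 - 1 / N) * quantile ρ (midpoint N i) + 1 / N * (m * i / N),
    fun N hN => ⟨fun i hi j hj hij => ?_, fun i hi => ?_⟩, ?_⟩
  · have hN' : (0 : ℝ) < N := by positivity
    have h1 : quantile ρ (midpoint N i) ≤ quantile ρ (midpoint N j) :=
      monotoneOn_quantile ρ (midpoint_mem (by simpa using hi)) (midpoint_mem (by simpa using hj))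
        (midpoint_lt (by omega) hij).le
    have h2 : (0 : ℝ) ≤ 1 - 1 / N := by
      rw [sub_nonneg, div_le_one hN']
      exact_mod_cast (by omega : 1 ≤ N)
    have h3 : (i : ℝ) < j := by exact_mod_cast hij
    refine add_lt_add_of_le_of_lt (by gcongr) ?_
    gcongr
  · have hi' : i ∈ Finset.Icc 1 N := by simpa using hi
    have hN1 : (1 : ℝ) ≤ N := by exact_mod_cast (by omega : 1 ≤ N)
    refine hconv (quantile_mem_carrier hρ.2.1 (midpoint_mem hi')) (hmD (hy hi')) ?_ (by positivity)
      (by ring)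
    rw [sub_nonneg, div_le_one (by linarith)]
    exact hN1
  · refine tendsto_d2_empirical (integrable_sq_of_mem_P2 hρ) fun N i hi => ?_
    have hyi := hy hi
    have e : (1 - 1 / (N : ℝ)) * quantile ρ (midpoint N i) + 1 / N * (m * i / N) -
        quantile ρ (midpoint N i) = (m * i / N - quantile ρ (midpoint N i)) / N := by ring
    rw [e, abs_div, Nat.abs_cast]
    gcongr
    have := abs_sub (m * i / N) (quantile ρ (midpoint N i))
    rw [abs_of_nonneg hyi.1] at this
    linarith [hyi.2]

/-! ### Recovery sequences for densities of finite energy -/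

section Recovery

variable {H : ℝ → ℝ} {D : Domain} {ρ : Measure ℝ}

/-- Particles at the quantiles of `ρ`. -/
noncomputable def quantileParticles (ρ : Measure ℝ) (N i : ℕ) : ℝ := quantile ρ (midpoint N i)

theorem isParticles_quantileParticles (hρ : ρ ∈ P2 D) (hac : ρ ≪ volume) {N : ℕ} (hN : 0 < N) :
    IsParticles D N (quantileParticles ρ N) := by
  have := hρ.1
  constructor
  · intro i hi j hj hij
    have hi' := midpoint_mem (N := N) (i := i) (by simpa using hi)
    have hj' := midpoint_mem (N := N) (i := j) (by simpa using hj)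
    have hlt := midpoint_lt hN hij
    refine (monotoneOn_quantile ρ hi' hj' hlt.le).lt_of_ne fun h => hlt.ne ?_
    rw [← cdf_quantile hac hi', ← cdf_quantile hac hj', h]
  · intro i hi
    exact quantile_mem_carrier hρ.2.1 (midpoint_mem (by simpa using hi))

theorem integral_density_Ioc [IsProbabilityMeasure ρ] (hac : ρ ≪ volume) {a b : ℝ} (hab : a ≤ b) :
    ∫ x in Set.Ioc a b, density ρ x = cdf ρ b - cdf ρ a := by
  have h1 : ∫ x in Set.Ioc a b, density ρ x = ρ.real (Set.Ioc a b) :=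
    Measure.setIntegral_toReal_rnDeriv hac _
  have h2 : ρ (Set.Ioc a b) = ENNReal.ofReal (cdf ρ b - cdf ρ a) := by
    conv_lhs => rw [← measure_cdf ρ]
    rw [StieltjesFunction.measure_Ioc]
  rw [h1, measureReal_def, h2, ENNReal.toReal_ofReal (sub_nonneg.2 (monotone_cdf ρ hab))]

/-- Jensen's inequality on a cell of mass `1 / N`. -/
theorem IsAdmissible.cell_le [IsProbabilityMeasure ρ] (hH : IsAdmissible H) (hac : ρ ≪ volume)
    (hi : Integrable fun x => H (density ρ x)) {N : ℕ} (hN : 0 < N) {a b : ℝ} (hab : a < b)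
    (hmass : cdf ρ b - cdf ρ a = 1 / N) :
    1 / (N : ℝ) * max (hOf H (N * (b - a))) 0 ≤
      ∫ x in Set.Ioc a b, max (H (density ρ x)) 0 := by
  have hN' : (0 : ℝ) < N := by exact_mod_cast hN
  have hba : 0 < b - a := sub_pos.2 hab
  -- Jensen is applied to the positive part of H, so that the gap energies are non-negative and
  -- cells may be added or discarded freely.
  have hcv : ConvexOn ℝ (Set.Ici 0) fun s => max (H s) 0 :=
    hH.convex.sup (convexOn_const 0 (convex_Ici 0))
  have hct : ContinuousOn (fun s => max (H s) 0) (Set.Ici 0) :=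
    hH.continuousOn.sup continuousOn_const
  have hvol : volume.real (Set.Ioc a b) = b - a := by
    rw [Real.volume_real_Ioc_of_le hab.le]
  have hJ := hcv.map_set_average_le (μ := volume) (t := Set.Ioc a b) (f := density ρ) hct isClosed_Ici
    (by simp [hab]) (by simp) (ae_of_all _ fun x => density_nonneg ρ x)
    (integrable_density ρ).integrableOn hi.pos_part.integrableOn
  rw [setAverage_eq, setAverage_eq, hvol, integral_density_Ioc hac hab.le, hmass, smul_eq_mul,
    smul_eq_mul] at hJ
  have e1 : (b - a)⁻¹ * (1 / (N : ℝ)) = ((N : ℝ) * (b - a))⁻¹ := by field_simp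
  rw [e1] at hJ
  have e2 : 1 / (N : ℝ) * max (hOf H (N * (b - a))) 0 =
      (b - a) * max (H ((N : ℝ) * (b - a))⁻¹) 0 := by
    rw [mul_max_of_nonneg _ _ (by positivity), mul_max_of_nonneg _ _ hba.le, hOf]
    congr 1
    · field_simp
    · ring
  rw [e2]
  calc (b - a) * max (H ((N : ℝ) * (b - a))⁻¹) 0
      ≤ (b - a) * ((b - a)⁻¹ * ∫ x in Set.Ioc a b, max (H (density ρ x)) 0) := by gcongr
    _ = _ := by field_simp

theorem midpoint_succ {N : ℕ} (hN : 0 < N) (i : ℕ) :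
    midpoint N (i + 1) - midpoint N i = 1 / N := by
  have hN' : (0 : ℝ) < N := by exact_mod_cast hN
  unfold midpoint
  push_cast
  field_simp
  ring

theorem cdf_quantileParticles_succ [IsProbabilityMeasure ρ] (hac : ρ ≪ volume) {N i : ℕ}
    (hi : 1 ≤ i) (hiN : i + 1 ≤ N) :
    cdf ρ (quantileParticles ρ N (i + 1)) - cdf ρ (quantileParticles ρ N i) = 1 / N := by
  rw [quantileParticles, quantileParticles,
    cdf_quantile hac (midpoint_mem (Finset.mem_Icc.2 ⟨by omega, hiN⟩)),
    cdf_quantile hac (midpoint_mem (Finset.mem_Icc.2 ⟨hi, by omega⟩)),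
    midpoint_succ (by omega)]

/-- The energy of the gap between the particles `i` and `i + 1`. -/
noncomputable def gapEnergy (H : ℝ → ℝ) (N : ℕ) (x : ℕ → ℝ) (i : ℕ) : ℝ :=
  max (hOf H (N * (x (i + 1) - x i))) 0

/-- An upper bound of the energy of the particle `i`. -/
noncomputable def neighbourEnergy (H : ℝ → ℝ) (N : ℕ) (x : ℕ → ℝ) (i : ℕ) : ℝ :=
  (if 2 ≤ i then gapEnergy H N x (i - 1) else 0) + if i + 1 ≤ N then gapEnergy H N x i else 0

theorem gapEnergy_nonneg (H : ℝ → ℝ) (N : ℕ) (x : ℕ → ℝ) (i : ℕ) : 0 ≤ gapEnergy H N x i :=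
  le_max_right _ _

/-- Every gap is counted by both of its end particles. -/
theorem sum_neighbourEnergy (H : ℝ → ℝ) (N : ℕ) (x : ℕ → ℝ) :
    ∑ i ∈ Finset.Icc 1 (N + 1), neighbourEnergy H (N + 1) x i =
      2 * ∑ i ∈ Finset.Icc 1 N, gapEnergy H (N + 1) x i := by
  simp only [neighbourEnergy]
  rw [Finset.sum_add_distrib, two_mul]
  congr 1
  · rw [← Finset.sum_filter]
    refine Finset.sum_nbij' (fun i => i - 1) (fun i => i + 1) ?_ ?_ ?_ ?_ ?_
    · intro i hi
      simp only [Finset.mem_filter, Finset.mem_Icc] at hi ⊢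
      omega
    · intro i hi
      simp only [Finset.mem_filter, Finset.mem_Icc] at hi ⊢
      omega
    · intro i hi
      simp only [Finset.mem_filter, Finset.mem_Icc] at hi
      omega
    · intro i _
      rfl
    · intro i _
      rfl
  · rw [← Finset.sum_filter]
    refine Finset.sum_congr ?_ fun _ _ => rfl
    ext i
    simp only [Finset.mem_filter, Finset.mem_Icc]
    omega

theorem IsAdmissible.sum_gapEnergy_le [IsProbabilityMeasure ρ] (hH : IsAdmissible H)
    (hac : ρ ≪ volume) (hi : Integrable fun x => H (density ρ x)) (N : ℕ)
    (hx : IsParticles D (N + 1) (quantileParticles ρ (N + 1))) :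
    1 / ((N + 1 : ℕ) : ℝ) * ∑ i ∈ Finset.Icc 1 N,
      gapEnergy H (N + 1) (quantileParticles ρ (N + 1)) i ≤ ∫ x, max (H (density ρ x)) 0 := by
  set x := quantileParticles ρ (N + 1) with hxdef
  have hmi : Integrable fun y => max (H (density ρ y)) 0 := hi.pos_part
  have key : ∀ n, n ≤ N → 1 / ((N + 1 : ℕ) : ℝ) * ∑ i ∈ Finset.Icc 1 n, gapEnergy H (N + 1) x i ≤
      ∫ y in x 1..x (n + 1), max (H (density ρ y)) 0 := by
    intro n
    induction n with
    | zero => intro _; simp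
    | succ n ih =>
      intro hn
      have hlt : x (n + 1) < x (n + 1 + 1) := hx.lt (by omega) (by omega) (by omega)
      rw [Finset.sum_Icc_succ_top (by omega), mul_add,
        ← intervalIntegral.integral_add_adjacent_intervals (b := x (n + 1))
          hmi.intervalIntegrable hmi.intervalIntegrable]
      refine add_le_add (ih (by omega)) ?_
      rw [intervalIntegral.integral_of_le hlt.le]
      exact hH.cell_le hac hi (by omega) hlt (cdf_quantileParticles_succ hac (by omega) (by omega))
  refine (key N le_rfl).trans ?_
  have hle : x 1 ≤ x (N + 1) :=
    hx.1.monotoneOn ⟨le_rfl, by omega⟩ ⟨by omega, le_rfl⟩ (by omega)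
  rw [intervalIntegral.integral_of_le hle]
  exact setIntegral_le_integral hmi (ae_of_all _ fun y => le_max_right _ _)

/-- The radius equals one of the genuine neighbouring gaps, and the term of the other is
non-negative. -/
theorem IsParticles.hOf_radius_le {N : ℕ} {x : ℕ → ℝ} (hx : IsParticles D N x) (hN : 2 ≤ N)
    {i : ℕ} (hi : i ∈ Finset.Icc 1 N) :
    hOf H (N * radius D N x i) ≤ neighbourEnergy H N x i := by
  rw [Finset.mem_Icc] at hi
  have h1 : 0 ≤ if 2 ≤ i then gapEnergy H N x (i - 1) else 0 := by
    split_ifs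
    exacts [gapEnergy_nonneg _ _ _ _, le_rfl]
  have h2 : 0 ≤ if i + 1 ≤ N then gapEnergy H N x i else 0 := by
    split_ifs
    exacts [gapEnergy_nonneg _ _ _ _, le_rfl]
  unfold neighbourEnergy
  rcases hx.radius_cases hN hi.1 hi.2 with ⟨h, e⟩ | ⟨h, e⟩
  · refine le_add_of_le_of_nonneg ?_ h2
    rw [if_pos h, e, gapEnergy, Nat.sub_add_cancel hi.1]
    exact le_max_left _ _
  · refine le_add_of_nonneg_of_le h1 ?_
    rw [if_pos h, e, gapEnergy]
    exact le_max_left _ _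

/-- For fixed u the particle of its cell is eventually not extremal, so pointwise limits never see
the boundary conventions. -/
theorem eventually_ceil_interior {u : ℝ} (hu : u ∈ Set.Ioo (0 : ℝ) 1) :
    ∀ᶠ N : ℕ in atTop, 2 ≤ ⌈(N : ℝ) * u⌉₊ ∧ ⌈(N : ℝ) * u⌉₊ + 1 ≤ N := by
  have h1 : Tendsto (fun N : ℕ => (N : ℝ) * u) atTop atTop :=
    tendsto_natCast_atTop_atTop.atTop_mul_const hu.1
  have h2 : Tendsto (fun N : ℕ => (N : ℝ) * (1 - u)) atTop atTop :=
    tendsto_natCast_atTop_atTop.atTop_mul_const (by linarith [hu.2])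
  filter_upwards [h1.eventually_ge_atTop 2, h2.eventually_ge_atTop 2] with N hN1 hN2
  have h3 := Nat.le_ceil ((N : ℝ) * u)
  have h4 := Nat.ceil_lt_add_one (a := (N : ℝ) * u) (by linarith)
  constructor
  · exact_mod_cast hN1.trans h3
  · have : ((⌈(N : ℝ) * u⌉₊ + 1 : ℕ) : ℝ) ≤ N := by
      push_cast
      linarith
    exact_mod_cast this

theorem tendsto_quantileParticles_gap {u d : ℝ} (hu : u ∈ Set.Ioo (0 : ℝ) 1)
    (hd : HasDerivAt (quantile ρ) d u) :
    Tendsto (fun N : ℕ => (N : ℝ) * (quantileParticles ρ N (⌈(N : ℝ) * u⌉₊ + 1) -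
      quantileParticles ρ N ⌈(N : ℝ) * u⌉₊)) atTop (𝓝 d) ∧
    Tendsto (fun N : ℕ => (N : ℝ) * (quantileParticles ρ N ⌈(N : ℝ) * u⌉₊ -
      quantileParticles ρ N (⌈(N : ℝ) * u⌉₊ - 1))) atTop (𝓝 d) := by
  have hmid : ∀ᶠ N : ℕ in atTop, |midpoint N ⌈(N : ℝ) * u⌉₊ - u| ≤ 2 / N := by
    filter_upwards [eventually_gt_atTop 0] with N hN
    refine (abs_midpoint_ceil_sub_le hN hu.1).trans ?_
    gcongr
    norm_num
  constructor
  · refine tendsto_mul_sub_of_hasDerivAt (C := 2) hd hmid ?_ ?_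
    · filter_upwards [eventually_gt_atTop 0] with N hN
      have h1 := midpoint_succ hN ⌈(N : ℝ) * u⌉₊
      have h2 := abs_midpoint_ceil_sub_le hN hu.1
      have h3 : (0 : ℝ) ≤ 1 / N := by positivity
      have h4 : (2 : ℝ) / N = 1 / N + 1 / N := by ring
      rw [abs_le] at h2 ⊢
      constructor <;> linarith [h2.1, h2.2]
    · filter_upwards [eventually_gt_atTop 0] with N hN
      exact midpoint_succ hN _
  · have hpred : ∀ᶠ N : ℕ in atTop, midpoint N ⌈(N : ℝ) * u⌉₊ -
        midpoint N (⌈(N : ℝ) * u⌉₊ - 1) = 1 / N := by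
      filter_upwards [eventually_gt_atTop 0, eventually_ceil_interior hu] with N hN h
      have h1 := midpoint_succ hN (⌈(N : ℝ) * u⌉₊ - 1)
      rwa [Nat.sub_add_cancel (by omega)] at h1
    refine tendsto_mul_sub_of_hasDerivAt (C := 2) hd ?_ hmid hpred
    filter_upwards [eventually_gt_atTop 0, hpred] with N hN h1
    have h2 := abs_midpoint_ceil_sub_le hN hu.1
    have h3 : (0 : ℝ) ≤ 1 / N := by positivity
    have h4 : (2 : ℝ) / N = 1 / N + 1 / N := by ring
    rw [abs_le] at h2 ⊢
    constructor <;> linarith [h2.1, h2.2]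

theorem hOf_inv_mul_density (hH0 : H 0 = 0) (x : ℝ) :
    hOf H (density ρ x)⁻¹ * density ρ x = H (density ρ x) := by
  rcases eq_or_ne (density ρ x) 0 with h | h
  · simp [h, hH0]
  · rw [hOf, inv_inv]
    field_simp

/-- Both neighbouring gaps, scaled by N, tend to 1/ρ, so the majorant tends to twice the positive
part of h(1/ρ). The factor 2 is harmless: the sum of Jensen's inequalities over the gaps carries the
same factor, as reverse Fatou requires. -/
theorem IsAdmissible.eventually_particleEnergy_lt (hH : IsAdmissible H) (hρ : ρ ∈ P2 D)
    (hac : ρ ≪ volume) (hi : Integrable fun x => H (density ρ x)) {ε : ℝ} (hε : 0 < ε) :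
    ∀ᶠ N : ℕ in atTop, particleEnergy H D N (quantileParticles ρ N) <
      (∫ x, H (density ρ x)) + ε := by
  have := hρ.1
  have hx : ∀ N, 0 < N → IsParticles D N (quantileParticles ρ N) := fun N hN =>
    isParticles_quantileParticles hρ hac hN
  -- In quantile coordinates H(ρ) dx becomes h(1/ρ) du, because h(1/s) s = H(s).
  set φ : ℝ → ℝ := fun x => hOf H (density ρ x)⁻¹ with hφ
  have hφm : Measurable φ := by
    have h1 : Measurable fun x => H (density ρ x) :=
      hH.measurable_comp (measurable_density ρ) (density_nonneg ρ)
    simp only [hφ, hOf, inv_inv]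
    exact (measurable_density ρ).inv.mul h1
  have hφd : ∀ x, φ x * density ρ x = H (density ρ x) := hOf_inv_mul_density hH.zero
  have hφi : Integrable φ ρ := by
    rw [← integrable_rnDeriv_smul_iff hac]
    refine hi.congr (ae_of_all _ fun x => ?_)
    simp only [smul_eq_mul]
    rw [← hφd x, mul_comm, density]
  have hφint : ∫ u, φ (quantile ρ u) ∂unitMeasure = ∫ x, H (density ρ x) := by
    rw [integral_quantile_comp hφm, ← integral_mul_density hac]
    simp only [hφd]
  have hφpint : ∫ u, 2 * max (φ (quantile ρ u)) 0 ∂unitMeasure =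
      2 * ∫ x, max (H (density ρ x)) 0 := by
    rw [integral_const_mul, integral_quantile_comp (φ := fun x => max (φ x) 0)
      (hφm.max measurable_const), ← integral_mul_density hac]
    congr 1
    refine integral_congr_ae (ae_of_all _ fun x => ?_)
    simp only
    rw [max_mul_of_nonneg _ _ (density_nonneg ρ x), hφd, zero_mul]
  have hlimits : ∀ᵐ u ∂unitMeasure,
      Tendsto (fun N : ℕ => hOf H (N * radius D N (quantileParticles ρ N) ⌈(N : ℝ) * u⌉₊)) atTop
        (𝓝 (φ (quantile ρ u))) ∧
      Tendsto (fun N : ℕ => neighbourEnergy H N (quantileParticles ρ N) ⌈(N : ℝ) * u⌉₊) atTop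
        (𝓝 (2 * max (φ (quantile ρ u)) 0)) := by
    filter_upwards [ae_mem_unit, ae_hasDerivAt_quantile hac] with u hu ⟨hpos, hd⟩
    obtain ⟨hr, hl⟩ := tendsto_quantileParticles_gap hu hd
    have hc : ContinuousAt (hOf H) (density ρ (quantile ρ u))⁻¹ :=
      hH.continuousOn_hOf.continuousAt (Ioi_mem_nhds (inv_pos.2 hpos))
    constructor
    · have hmin := hl.min hr
      rw [min_self] at hmin
      refine (hc.tendsto.comp hmin).congr' ?_
      filter_upwards [eventually_ceil_interior hu] with N hN
      rw [radius_interior hN.1 hN.2, mul_min_of_nonneg _ _ (Nat.cast_nonneg N)]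
      rfl
    · have h1 := ((hc.tendsto.comp hl).max (tendsto_const_nhds (x := (0 : ℝ)))).add
        ((hc.tendsto.comp hr).max (tendsto_const_nhds (x := (0 : ℝ))))
      rw [← two_mul] at h1
      refine h1.congr' ?_
      filter_upwards [eventually_ceil_interior hu] with N hN
      rw [neighbourEnergy, if_pos hN.1, if_pos hN.2, gapEnergy, gapEnergy,
        Nat.sub_add_cancel (by omega)]
      rfl
  have hN2 : ∀ n : ℕ, 0 < n + 2 := fun n => by omega
  -- The shift by 2 makes the bounds on radii, which need two particles, valid for every index.
  have hmain := eventually_integral_lt_of_le_majorant (μ := unitMeasure)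
    (ψ := fun n u => hOf H ((n + 2 : ℕ) *
      radius D (n + 2) (quantileParticles ρ (n + 2)) ⌈((n + 2 : ℕ) : ℝ) * u⌉₊))
    (G := fun n u => neighbourEnergy H (n + 2) (quantileParticles ρ (n + 2))
      ⌈((n + 2 : ℕ) : ℝ) * u⌉₊)
    (g := fun u => φ (quantile ρ u)) (G₀ := fun u => 2 * max (φ (quantile ρ u)) 0)
    (fun n => integrable_step (hN2 n) fun i => hOf H ((n + 2 : ℕ) *
      radius D (n + 2) (quantileParticles ρ (n + 2)) i))
    (fun n => integrable_step (hN2 n) _)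
    (integrable_quantile_comp hφi) ((integrable_quantile_comp hφi).pos_part.const_mul 2)
    (fun n => by
      filter_upwards [ae_mem_unit] with u hu
      exact (hx _ (hN2 n)).hOf_radius_le (by omega) (ceil_mem_Icc (hN2 n) hu))
    (hlimits.mono fun u hu => hu.1.comp (tendsto_add_atTop_nat 2))
    (hlimits.mono fun u hu => hu.2.comp (tendsto_add_atTop_nat 2))
    (fun n => by
      rw [integral_step (hN2 n), hφpint, sum_neighbourEnergy H (n + 1), mul_left_comm]
      gcongr
      exact hH.sum_gapEnergy_le hac hi (n + 1) (hx _ (hN2 n)))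
    hε
  obtain ⟨n₀, hn₀⟩ := eventually_atTop.1 hmain
  filter_upwards [eventually_ge_atTop (n₀ + 2)] with N hN
  obtain ⟨n, rfl⟩ := Nat.exists_eq_add_of_le' (show 2 ≤ N by omega)
  have h1 := hn₀ n (by omega)
  rw [hφint, integral_step (hN2 n) fun i => hOf H ((n + 2 : ℕ) *
    radius D (n + 2) (quantileParticles ρ (n + 2)) i)] at h1
  exact h1

end Recovery

/-! ### Assembly of the recovery sequence and of the theorem. -/

theorem IsAdmissible.exists_isRecoverySequence {H : ℝ → ℝ} (hH : IsAdmissible H) {D : Domain}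
    {ρ : Measure ℝ} (hρ : ρ ∈ P2 D) : ∃ μ : ℕ → Measure ℝ, IsRecoverySequence H D ρ μ := by
  have := hρ.1
  by_cases h : ρ ≪ volume ∧ Integrable fun x => H (density ρ x)
  · obtain ⟨hac, hi⟩ := h
    have hx : ∀ N, 0 < N → IsParticles D N (quantileParticles ρ N) := fun N hN =>
      isParticles_quantileParticles hρ hac hN
    refine ⟨fun N => empirical N (quantileParticles ρ N),
      fun N hN => empirical_mem_atomicMeasures hN (hx N (by omega)),
      tendsto_d2_empirical (integrable_sq_of_mem_P2 hρ) fun N i _ => ?_, ?_⟩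
    · rw [quantileParticles, sub_self, abs_zero]
      positivity
    · rw [hH.continuumEnergy_eq_line D hρ.2.1,
        IsAdmissible.continuumEnergy_line_of_integrable hac hi]
      -- It suffices to bound the limsup by every real z above the energy; the slack ε is the
      -- difference.
      refine EReal.le_of_forall_lt_iff_le.1 fun z hz => ?_
      rw [EReal.coe_lt_coe_iff] at hz
      refine limsup_le_of_le (by isBoundedDefault) ?_
      filter_upwards [eventually_ge_atTop 2,
        hH.eventually_particleEnergy_lt hρ hac hi (sub_pos.2 hz)] with N hN hlt
      rw [discreteEnergy_empirical H D hN (hx N (by omega)), EReal.coe_le_coe_iff]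
      linarith
  · obtain ⟨x, hx, hd⟩ := exists_atomic_approx hρ
    refine ⟨fun N => empirical N (x N), fun N hN => empirical_mem_atomicMeasures hN (hx N hN), hd, ?_⟩
    rw [hH.continuumEnergy_eq_line D hρ.2.1,
      hH.continuumEnergy_line_eq_top (integrable_abs_of_mem_P2 hρ) h]
    exact le_top

end ParticleDiffusion

theorem theorem5p2 (D : ParticleDiffusion.Domain) (H : ℝ → ℝ)
    (hH : ParticleDiffusion.IsHeatEntropy H ∨
      (ParticleDiffusion.IsGeneralDensity H ∧ ParticleDiffusion.HasScalingBound H)) :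
    ParticleDiffusion.GammaConverges H D := by
  have hA : ParticleDiffusion.IsAdmissible H :=
    hH.elim (fun h => h.isAdmissible) fun h => h.1.isAdmissible
  exact fun ρ hρ => ⟨fun μ hμ hd => hA.continuumEnergy_le_liminf hρ hμ hd,
    hA.exists_isRecoverySequence hρ⟩
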